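/- **Setting.** Consider the system $x_{h+1} = A_\star\,\phi(x_h,u_h) + w_h$ with states in $\mathbb R^{d_x}$, inputs $u_h \in \mathcal U \subseteq \mathbb R^{d_u}$, noise $w_h \sim \mathcal N(0,\sigma_w^2 I)$ independent of the past ($\sigma_w>0$), a known measurable feature map $\phi$ with values in $\mathbb R^{d_\phi}$ and $\|\phi(x,u)\|_2 \le B_\phi$, and an unknown $A_\star \in \mathbb R^{d_x\times d_\phi}$ with $\|A_\star\|_{\mathrm{op}} \le B_A$ for a known $B_A>0$. Episodes have length $H\ge 1$ and start from a given state $x_1$. The stage costs $\mathrm{cost}_h \ge 0$ are known and measurable, and every trajectory has total cost $\sum_{h=1}^H \mathrm{cost}_h(x_h,u_h) \le c_{\max}$. Let $\mathcal J(\pi;A)$ be the expected total cost of a (possibly randomized, history-dependent) policy $\pi$ on the system with parameter $A$. **Algorithm.** Let $\Pi$ be any policy class, $T \ge 1$ and $\delta\in(0,1)$. LC³ with regularizer $\lambda>0$ does the following in each episode $t=1,\dots,T$. From the past episodes $s<t$ it forms $$\Sigma = \lambda I + \sum_{s<t}\sum_{h=1}^H \phi(x_h^s,u_h^s)\phi(x_h^s,u_h^s)^\top,\qquad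 \bar A = \arg\min_A \sum_{s<t}\sum_{h=1}^H \|x_{h+1}^s - A\phi(x_h^s,u_h^s)\|_2^2 + \lambda\|A\|_F^2,$$ $$\beta = \sqrt\lambda\, B_A + \sigma_w\sqrt{8 d_x\log 5 + 8\log\big(T\det(\Sigma)\det(\lambda I)^{-1}/\delta\big)},\qquad \mathrm{Ball} = \{A : \|(A-\bar A)\Sigma^{1/2}\|_{\mathrm{op}} \le \beta\},$$ and plays a policy $\pi^t\in\Pi$ such that some pair $(\pi^t,\hat A^t)$ minimizes $\mathcal J(\pi;A)$ over $\pi\in\Pi$ and $A\in\mathrm{Ball}$ (these minima are attained and $\pi^t$ depends measurably on the past). The regret is $\mathcal R_T(\Pi) = \sum_{t=1}^T \mathcal J(\pi^t;A_\star) - T\inf_{\pi\in\Pi}\mathcal J(\pi;A_\star)$. **Theorem.** There is a universal constant $C>0$ such that the following holds in every such setting. 1. If $\lambda = \sigma_w^2/\max\{1,B_A\}$, and $B_A \le T$ or $\sigma_w \le B_\phi H T$, then with probability at least $1-\delta$ $$\mathcal R_T(\Pi) \le C\, c_{\max} H \sqrt{d_\phi\,\big(d_\phi+d_x+B_A+\log\tfrac1\delta\big)\,T}\;\log\!\Big(1+\frac{B_\phi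 H T}{\sigma_w}\Big).$$ 2. If $\lambda = \sigma_w^2$, then with probability at least $1-\delta$ the same bound holds with $B_A^2$ in place of $B_A$. -/

import Mathlib

open MeasureTheory ProbabilityTheory
open scoped Matrix.Norms.L2Operator MatrixOrder

noncomputable section

namespace LC3

/-- `ℝⁿ` with the Euclidean norm. -/
abbrev Vec (n : ℕ) : Type := EuclideanSpace ℝ (Fin n)

/-- What has been observed before the input of step `h` (steps are numbered from `0`) is chosen:
the `h` state-input pairs of the previous steps and the current state. An element of `Hist dx U H`
is a full trajectory of an episode of length `H`, ending with the state that follows its last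
step. -/
abbrev Hist (dx : ℕ) (U : Type) (h : ℕ) : Type := (Fin h → Vec dx × U) × Vec dx

/-- A (possibly randomized, history-dependent) policy: the law of the input of step `h` given the
history. Only the steps `h < H` of an episode of length `H` matter. -/
structure Policy (dx : ℕ) (U : Type) [MeasurableSpace U] where
  act : (h : ℕ) → Kernel (Hist dx U h) U
  isMarkov : ∀ h, IsMarkovKernel (act h)

variable {dx dφ : ℕ} {U : Type}

/-- The noise distribution `N(0, σ² I)`. -/
def noise (dx : ℕ) (σ : ℝ) : Measure (Vec dx) :=
  multivariateGaussian 0 (σ ^ 2 • (1 : Matrix (Fin dx) (Fin dx) ℝ))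

/-- One step `x' = A φ(x, u) + w` of the system, appended to the history. -/
def stepMap (A : Matrix (Fin dx) (Fin dφ) ℝ) (φ : Vec dx → U → Vec dφ) (h : ℕ)
    (p : (Hist dx U h × U) × Vec dx) : Hist dx U (h + 1) :=
  (Fin.snoc (α := fun _ => Vec dx × U) p.1.1.1 (p.1.1.2, p.1.2),
    A.toEuclideanLin (φ p.1.1.2 p.1.2) + p.2)

/-- The law of the first `h` steps of an episode that starts from `x₁` and in which the policy `π`
is played on the system with parameter `A`. -/
def trajLaw [MeasurableSpace U] (σ : ℝ) (x₁ : Vec dx) (φ : Vec dx → U → Vec dφ)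
    (A : Matrix (Fin dx) (Fin dφ) ℝ) (π : Policy dx U) : (h : ℕ) → Measure (Hist dx U h)
  | 0 => Measure.dirac (Fin.elim0, x₁)
  | h + 1 => ((trajLaw σ x₁ φ A π h ⊗ₘ π.act h).prod (noise dx σ)).map (stepMap A φ h)

/-- The cost of a trajectory, `∑ₕ costₕ(xₕ, uₕ)`. -/
def totalCost {H : ℕ} (cost : Fin H → Vec dx → U → ℝ) (s : Fin H → Vec dx × U) : ℝ :=
  ∑ h, cost h (s h).1 (s h).2

/-- `J(π; A)`, the expected cost of the policy `π` on the system with parameter `A`. -/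
def expCost [MeasurableSpace U] {H : ℕ} (σ : ℝ) (x₁ : Vec dx) (φ : Vec dx → U → Vec dφ)
    (cost : Fin H → Vec dx → U → ℝ) (π : Policy dx U) (A : Matrix (Fin dx) (Fin dφ) ℝ) : ℝ :=
  ∫ τ, totalCost cost τ.1 ∂(trajLaw σ x₁ φ A π H)

/-- The state that follows step `h` of a full trajectory. -/
def nextState {H : ℕ} (τ : Hist dx U H) (h : Fin H) : Vec dx :=
  if hh : h.val + 1 < H then (τ.1 ⟨h.val + 1, hh⟩).1 else τ.2

/-- The regularized covariates `λ I + ∑ₛ ∑ₕ φ(xₕˢ, uₕˢ) φ(xₕˢ, uₕˢ)ᵀ` of the trajectories of the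
first `t` episodes. -/
def covariates {H t : ℕ} (φ : Vec dx → U → Vec dφ) (lam : ℝ) (d : Fin t → Hist dx U H) :
    Matrix (Fin dφ) (Fin dφ) ℝ :=
  lam • 1 + ∑ s, ∑ h, Matrix.vecMulVec (φ ((d s).1 h).1 ((d s).1 h).2).ofLp
    (φ ((d s).1 h).1 ((d s).1 h).2).ofLp

/-- The regularized least-squares loss
`∑ₛ ∑ₕ ‖xₕ₊₁ˢ - A φ(xₕˢ, uₕˢ)‖² + λ ‖A‖_F²` of the first `t` episodes. -/
def ridgeLoss {H t : ℕ} (φ : Vec dx → U → Vec dφ) (lam : ℝ) (d : Fin t → Hist dx U H)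
    (A : Matrix (Fin dx) (Fin dφ) ℝ) : ℝ :=
  (∑ s, ∑ h, ‖nextState (d s) h - A.toEuclideanLin (φ ((d s).1 h).1 ((d s).1 h).2)‖ ^ 2)
    + lam * ∑ i, ∑ j, A i j ^ 2

/-- The confidence radius
`β = √λ B_A + σ √(8 dₓ log 5 + 8 log (T det(Σ) det(Σ₀)⁻¹ / δ))`, where `Σ` is the matrix of
covariates of the past episodes and `Σ₀ = λ I`. -/
def radius {H t : ℕ} (φ : Vec dx → U → Vec dφ) (T : ℕ) (σ BA δ lam : ℝ)
    (d : Fin t → Hist dx U H) : ℝ :=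
  √lam * BA + σ * √(8 * dx * Real.log 5 + 8 * Real.log
    (T * (covariates φ lam d).det * (lam • (1 : Matrix (Fin dφ) (Fin dφ) ℝ)).det⁻¹ / δ))

/-- The confidence set `{A : ‖(A - Ā) Σ^{1/2}‖_op ≤ β}` formed from the past episodes, where `Ā` is
the regularized least-squares estimate. (For `λ > 0` the minimizer `Ā` exists and is unique; the
matrix norm here is the operator norm for the Euclidean norms.) -/
def confSet {H t : ℕ} (φ : Vec dx → U → Vec dφ) (T : ℕ) (σ BA δ lam : ℝ)
    (d : Fin t → Hist dx U H) : Set (Matrix (Fin dx) (Fin dφ) ℝ) :=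
  {A | ∃ Abar, IsMinOn (ridgeLoss φ lam d) Set.univ Abar ∧
    ‖(A - Abar) * CFC.sqrt (covariates φ lam d)‖ ≤ radius φ T σ BA δ lam d}

/-- A learner chooses the policy of the next episode from the trajectories of the `t` episodes
completed so far. -/
abbrev Learner (dx : ℕ) (U : Type) [MeasurableSpace U] (H : ℕ) : Type :=
  (t : ℕ) → (Fin t → Hist dx U H) → Policy dx U

/-- The inputs played depend measurably on all past observations. -/
def Learner.IsMeasurable [MeasurableSpace U] {H : ℕ} (L : Learner dx U H) : Prop :=
  ∀ t h, Measurable fun p : (Fin t → Hist dx U H) × Hist dx U h => (L t p.1).act h p.2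

/-- `L` is the algorithm LC³ with regularizer `lam`, run for `T` episodes over the policy class
`Pol`: in each episode it plays an optimistic policy, that is, a `π` for which some `(π, Â)`
minimizes `J(π; A)` over all `π` in the class and `A` in the current confidence set. -/
def IsLC3 [MeasurableSpace U] {H : ℕ} (σ : ℝ) (x₁ : Vec dx) (φ : Vec dx → U → Vec dφ)
    (cost : Fin H → Vec dx → U → ℝ) (Pol : Set (Policy dx U)) (T : ℕ) (BA δ lam : ℝ)
    (L : Learner dx U H) : Prop :=
  L.IsMeasurable ∧ ∀ t < T, ∀ d : Fin t → Hist dx U H,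
    L t d ∈ Pol ∧ ∃ Ahat ∈ confSet φ T σ BA δ lam d,
      ∀ π ∈ Pol, ∀ A ∈ confSet φ T σ BA δ lam d,
        expCost σ x₁ φ cost (L t d) Ahat ≤ expCost σ x₁ φ cost π A

/-- The law of the trajectories of the first `t` episodes when the learner `L` interacts with the
system with parameter `A`: given the past episodes `d`, the trajectory of the next episode is that
of the policy `L t d`. -/
def runLaw [MeasurableSpace U] {H : ℕ} (σ : ℝ) (x₁ : Vec dx) (φ : Vec dx → U → Vec dφ)
    (A : Matrix (Fin dx) (Fin dφ) ℝ) (L : Learner dx U H) : (t : ℕ) → Measure (Fin t → Hist dx U H)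
  | 0 => Measure.dirac Fin.elim0
  | t + 1 => (runLaw σ x₁ φ A L t).bind fun d =>
      (trajLaw σ x₁ φ A (L t d) H).map
        fun τ => (Fin.snoc (α := fun _ => Hist dx U H) d τ : Fin (t + 1) → Hist dx U H)

/-- The regret `∑ₜ J(πᵗ; A) - T · min_{π ∈ Pol} J(π; A)`, as a function of the observed
trajectories, which determine the policies `πᵗ` played. -/
def regret [MeasurableSpace U] {H T : ℕ} (σ : ℝ) (x₁ : Vec dx) (φ : Vec dx → U → Vec dφ)
    (cost : Fin H → Vec dx → U → ℝ) (Pol : Set (Policy dx U)) (A : Matrix (Fin dx) (Fin dφ) ℝ)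
    (L : Learner dx U H) (d : Fin T → Hist dx U H) : ℝ :=
  (∑ t : Fin T, expCost σ x₁ φ cost (L t fun s => d (Fin.castLE t.isLt.le s)) A)
    - T * sInf ((fun π => expCost σ x₁ φ cost π A) '' Pol)

end LC3

end

/-!
The proof is optimism in the face of uncertainty. It has two probabilistic halves.

*Simulation lemma.* Replacing the parameter `A` of the system by `A'` translates the law of the next
state by `(A' - A) φ`, and two translates of `N(0, σ² I)` by vectors at distance `r` give to a
function with values in `[0, M]` integrals that differ by at most `M min (1, 3 r / σ)`
(`lintegral_noise_shift_le`). Step by step along an episode it follows that the expected cost under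
`A` exceeds the one under `A'` by at most `c_max` times the expected sum of these errors along a
trajectory of the system with parameter `A` (`lintegral_trajLaw_le`). If `A` is the true parameter
and belongs to the confidence set, then the optimistic value is at most the optimal one, and this
sum, in which `r ≤ 2 β ‖φ‖_{Σ⁻¹}`, bounds the regret of the episode (`regret_le_sum_condExpect`).

*Confidence sets.* For `‖v‖ ≤ 1` and any `θ`, the exponential of the sum along the run of
`⟪φ, θ⟫ ⟪v, w⟫ / σ - ⟪φ, θ⟫² / 2` has mean at most one (`lintegral_runLaw_exp_le`). So does its
average over `v` uniform in the unit ball and `θ` Gaussian with precision `λ I`, which for every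
unit vector `u` is at least
`4^{-d_x} (det Σ / λ^{d_φ})^{-1/2} exp (‖S Σ^{-1/2} u‖² / (8 σ²))`, where `S = ∑ w φᵀ`
(`le_mixture`). Markov's inequality then bounds the operator norm of `S Σ^{-1/2}`, and hence the
distance of the ridge estimate from the true parameter. The average over the ball plays the part of
the usual net of the sphere, and only costs `4 ^ d_x`, while the claimed radius allows for
`5 ^ d_x`.

The failure probabilities are `δ / T` for each of the `T - 1` nonempty pasts, nothing for the empty
past, and `δ / T` for the passage from the conditional expectations of the errors to the errors
themselves (`measure_exceptional_le`). The latter rests on `E exp (E Z / 2 - Z) ≤ 1` for `Z` with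
values in `[0, 1]`.

The errors are then summed by the Cauchy-Schwarz inequality and the elliptical potential lemma
(`sq_sum_potential_le`): for each step `h` separately, the sum over `t` of
`log (1 + ‖φ_{t,h}‖²_{Σₜ⁻¹})` is at most the logarithm of `det Σ / λ^{d_φ}` at the end of the run.
Since `Σ` is updated only between episodes, this costs a factor `H`.

The bound obtained in this way contains `log T`, which the claimed one does not. It is good enough
when `x = B_φ H T / σ` is at least `1` and `log T` is at most of the order of
`log (1 + x) + 1 + B_A` (or `1 + B_A²` for the second regularizer). In the remaining cases either
the bound `c_max T` suffices or the errors are bounded by `‖φ‖_{Σ⁻¹} ≤ ‖φ‖ / √λ`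
(`regret_bound_cases`).
-/

namespace LC3

open scoped ENNReal RealInnerProductSpace

/-! ### The Gaussian noise -/

/-- The density of `N(0, σ² I)` with respect to the Lebesgue measure. The normalizing constant is
left as an integral. -/
noncomputable def gaussDensity {n : ℕ} (σ : ℝ) (x : Vec n) : ℝ :=
  (∫ y : Vec n, Real.exp (-(1 / (2 * σ ^ 2)) * ‖y‖ ^ 2))⁻¹ *
    Real.exp (-(1 / (2 * σ ^ 2)) * ‖x‖ ^ 2)

lemma integral_gauss_pos {n : ℕ} {b : ℝ} (hb : 0 < b) :
    0 < ∫ y : Vec n, Real.exp (-b * ‖y‖ ^ 2) := by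
  rw [GaussianFourier.integral_rexp_neg_mul_sq_norm hb]
  positivity

lemma integrable_gauss {n : ℕ} {b : ℝ} (hb : 0 < b) :
    Integrable fun y : Vec n => Real.exp (-b * ‖y‖ ^ 2) :=
  Integrable.of_integral_ne_zero (integral_gauss_pos hb).ne'

lemma gaussDensity_nonneg {n : ℕ} (σ : ℝ) (x : Vec n) : 0 ≤ gaussDensity σ x :=
  mul_nonneg (inv_nonneg.2 (integral_nonneg fun _ => (Real.exp_pos _).le)) (Real.exp_pos _).le

@[fun_prop]
lemma measurable_gaussDensity {n : ℕ} (σ : ℝ) :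
    Measurable (gaussDensity σ : Vec n → ℝ) := by
  unfold gaussDensity
  fun_prop

lemma integrable_gaussDensity {n : ℕ} {σ : ℝ} (hσ : 0 < σ) :
    Integrable (gaussDensity σ : Vec n → ℝ) :=
  (integrable_gauss (by positivity)).const_mul _

lemma lintegral_gaussDensity {n : ℕ} {σ : ℝ} (hσ : 0 < σ) :
    ∫⁻ x : Vec n, ENNReal.ofReal (gaussDensity σ x) = 1 := by
  rw [← ofReal_integral_eq_lintegral_ofReal (integrable_gaussDensity hσ)
    (.of_forall (gaussDensity_nonneg σ))]
  unfold gaussDensity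
  rw [integral_const_mul, inv_mul_cancel₀ (integral_gauss_pos (by positivity)).ne']
  simp

lemma noise_eq_withDensity {n : ℕ} {σ : ℝ} (hσ : 0 < σ) :
    noise n σ = volume.withDensity fun x => ENNReal.ofReal (gaussDensity σ x) := by
  have hfin := isFiniteMeasure_withDensity_ofReal
    (integrable_gaussDensity (n := n) hσ).hasFiniteIntegral
  have hpsd : (σ ^ 2 • (1 : Matrix (Fin n) (Fin n) ℝ)).PosSemidef :=
    Matrix.PosSemidef.one.smul (sq_nonneg σ)
  have : IsFiniteMeasure (noise n σ) := by unfold noise; infer_instance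
  -- both sides are finite measures with the same characteristic function
  apply Measure.ext_of_charFun
  ext t
  rw [noise, charFun_multivariateGaussian hpsd, charFun_apply,
    integral_withDensity_eq_integral_toReal_smul (by fun_prop) (by simp)]
  have hb : 0 < ((1 / (2 * σ ^ 2) : ℝ) : ℂ).re := by
    rw [Complex.ofReal_re]; positivity
  have h1 : ∀ x : Vec n, (ENNReal.ofReal (gaussDensity σ x)).toReal •
      Complex.exp (⟪x, t⟫ * Complex.I) =
      (((∫ y : Vec n, Real.exp (-(1 / (2 * σ ^ 2)) * ‖y‖ ^ 2))⁻¹ : ℝ) : ℂ) *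
      Complex.exp (-((1 / (2 * σ ^ 2) : ℝ) : ℂ) * ‖x‖ ^ 2 + Complex.I * ⟪t, x⟫) := by
    intro x
    rw [ENNReal.toReal_ofReal (gaussDensity_nonneg σ x), gaussDensity, Complex.exp_add,
      Complex.real_smul, real_inner_comm]
    push_cast
    ring_nf
  simp_rw [h1]
  rw [integral_const_mul, GaussianFourier.integral_cexp_neg_mul_sq_norm_add hb]
  have h2 := GaussianFourier.integral_cexp_neg_mul_sq_norm (V := Vec n) hb
  have h3 : ((∫ y : Vec n, Real.exp (-(1 / (2 * σ ^ 2)) * ‖y‖ ^ 2) : ℝ) : ℂ) =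
      ∫ v : Vec n, Complex.exp (-((1 / (2 * σ ^ 2) : ℝ) : ℂ) * ‖v‖ ^ 2) := by
    rw [← integral_complex_ofReal]
    congr with v
    push_cast
    rfl
  rw [Complex.ofReal_inv, ← h2, ← h3, inv_mul_cancel_left₀]
  · have h4 : t.ofLp ⬝ᵥ ((σ ^ 2 • (1 : Matrix (Fin n) (Fin n) ℝ)).mulVec t.ofLp) =
        σ ^ 2 * ‖t‖ ^ 2 := by
      rw [Matrix.smul_mulVec, Matrix.one_mulVec, dotProduct_smul, EuclideanSpace.real_norm_sq_eq]
      simp [dotProduct, sq]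
    rw [h4]
    have : (σ : ℂ) ≠ 0 := by exact_mod_cast hσ.ne'
    congr 1
    simp only [inner_zero_right]
    push_cast
    rw [Complex.I_sq]
    field_simp
    ring
  · exact Complex.ofReal_ne_zero.2
      (integral_gauss_pos (n := n) (b := 1 / (2 * σ ^ 2)) (by positivity)).ne'

instance isProbabilityMeasure_noise {n : ℕ} (σ : ℝ) : IsProbabilityMeasure (noise n σ) := by
  unfold noise; infer_instance

lemma lintegral_noise {n : ℕ} {σ : ℝ} (hσ : 0 < σ) {f : Vec n → ℝ≥0∞} (hf : Measurable f) :
    ∫⁻ w, f w ∂noise n σ = ∫⁻ x, ENNReal.ofReal (gaussDensity σ x) * f x := by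
  rw [noise_eq_withDensity hσ, lintegral_withDensity_eq_lintegral_mul _ (by fun_prop) hf]
  rfl

/-- A shift of the argument moved to the density. -/
lemma lintegral_noise_shift {n : ℕ} {σ : ℝ} (hσ : 0 < σ) (a : Vec n) {f : Vec n → ℝ≥0∞}
    (hf : Measurable f) :
    ∫⁻ w, f (a + w) ∂noise n σ = ∫⁻ x, ENNReal.ofReal (gaussDensity σ (x - a)) * f x := by
  rw [lintegral_noise hσ (by fun_prop),
    ← lintegral_sub_right_eq_self (μ := volume)
      (fun x => ENNReal.ofReal (gaussDensity σ x) * f (a + x)) a]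
  simp

/-- The effect of a shift on the Gaussian density. -/
lemma gaussDensity_sub {n : ℕ} {σ : ℝ} (hσ : 0 < σ) (x a : Vec n) :
    gaussDensity σ (x - a) =
      Real.exp (⟪a, x⟫ / σ ^ 2 - ‖a‖ ^ 2 / (2 * σ ^ 2)) * gaussDensity σ x := by
  unfold gaussDensity
  rw [mul_left_comm, ← Real.exp_add, norm_sub_sq_real, real_inner_comm]
  congr 2
  field_simp
  ring

lemma lintegral_exp_inner_noise {n : ℕ} {σ : ℝ} (hσ : 0 < σ) (v : Vec n) :
    ∫⁻ w, ENNReal.ofReal (Real.exp ⟪v, w⟫) ∂noise n σ =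
      ENNReal.ofReal (Real.exp (σ ^ 2 * ‖v‖ ^ 2 / 2)) := by
  rw [lintegral_noise hσ (by fun_prop)]
  have h : ∀ x : Vec n, ENNReal.ofReal (gaussDensity σ x) * ENNReal.ofReal (Real.exp ⟪v, x⟫) =
      ENNReal.ofReal (Real.exp (σ ^ 2 * ‖v‖ ^ 2 / 2)) *
        ENNReal.ofReal (gaussDensity σ (x - σ ^ 2 • v)) := by
    intro x
    rw [← ENNReal.ofReal_mul (gaussDensity_nonneg _ _), ← ENNReal.ofReal_mul (Real.exp_pos _).le,
      gaussDensity_sub hσ, ← mul_assoc, ← Real.exp_add, mul_comm (gaussDensity σ x)]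
    congr 3
    rw [norm_smul, inner_smul_left, Real.norm_eq_abs, mul_pow, sq_abs]
    simp only [conj_trivial]
    field_simp
    ring
  simp_rw [h]
  rw [lintegral_const_mul _ (by fun_prop),
    lintegral_sub_right_eq_self (fun x => ENNReal.ofReal (gaussDensity σ x)) (σ ^ 2 • v),
    lintegral_gaussDensity hσ, mul_one]

lemma lintegral_abs_inner_noise_le {n : ℕ} {σ : ℝ} (hσ : 0 < σ) (a : Vec n) :
    ∫⁻ w, ENNReal.ofReal |⟪a, w⟫| ∂noise n σ ≤ ENNReal.ofReal (2 * σ * ‖a‖) := by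
  rcases eq_or_ne a 0 with rfl | ha
  · simp
  have hna : 0 < ‖a‖ := norm_pos_iff.2 ha
  -- rescale `a` so that `⟪v, w⟫` is standard normal, and use `|s| ≤ cosh s`
  set v : Vec n := (σ * ‖a‖)⁻¹ • a with hv
  have hvn : ‖v‖ = σ⁻¹ := by
    rw [hv, norm_smul, Real.norm_of_nonneg (by positivity)]
    field_simp
  have hav : a = (σ * ‖a‖) • v := by
    rw [hv, smul_smul, mul_inv_cancel₀ (by positivity), one_smul]
  have habs : ∀ s : ℝ, |s| ≤ 2⁻¹ * (Real.exp s + Real.exp (-s)) := by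
    intro s
    have h1 := Real.add_one_le_exp s
    have h2 := Real.add_one_le_exp (-s)
    have h3 := Real.quadratic_le_exp_of_nonneg (abs_nonneg s)
    have h4 : Real.exp |s| + Real.exp (-|s|) = Real.exp s + Real.exp (-s) := by
      rcases abs_cases s with ⟨h, _⟩ | ⟨h, _⟩ <;> rw [h]
      rw [neg_neg, add_comm]
    have h5 := Real.add_one_le_exp (-|s|)
    nlinarith [sq_nonneg (|s| - 2), Real.exp_pos (-|s|), abs_nonneg s]
  have hpt : ∀ w, ENNReal.ofReal |⟪a, w⟫| ≤ ENNReal.ofReal (σ * ‖a‖ * 2⁻¹) *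
      (ENNReal.ofReal (Real.exp ⟪v, w⟫) + ENNReal.ofReal (Real.exp ⟪-v, w⟫)) := by
    intro w
    rw [← ENNReal.ofReal_add (Real.exp_pos _).le (Real.exp_pos _).le,
      ← ENNReal.ofReal_mul (by positivity)]
    apply ENNReal.ofReal_le_ofReal
    conv_lhs => rw [hav]
    rw [inner_smul_left, inner_neg_left, abs_mul, mul_assoc]
    simp only [conj_trivial]
    rw [abs_of_pos (by positivity : 0 < σ * ‖a‖)]
    exact mul_le_mul_of_nonneg_left (habs _) (by positivity)
  refine (lintegral_mono hpt).trans ?_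
  rw [lintegral_const_mul _ (by fun_prop), lintegral_add_left (by fun_prop),
    lintegral_exp_inner_noise hσ, lintegral_exp_inner_noise hσ, norm_neg, hvn,
    ← ENNReal.ofReal_add (Real.exp_pos _).le (Real.exp_pos _).le,
    ← ENNReal.ofReal_mul (by positivity)]
  apply ENNReal.ofReal_le_ofReal
  have h1 : σ ^ 2 * σ⁻¹ ^ 2 / 2 = 1 / 2 := by field_simp
  have h2 : Real.exp (1 / 2) ≤ 2 := by
    have h3 : Real.exp (1 / 2) ^ 2 = Real.exp 1 := by rw [← Real.exp_nat_mul]; norm_num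
    have := Real.exp_one_lt_d9
    nlinarith [Real.exp_pos (1 / 2)]
  rw [h1]
  nlinarith [mul_pos hσ hna]

/-- Two Gaussians with covariance `σ² I` whose means differ by `r` are at total variation distance
at most `min 1 (3 r / σ)`, in the form of a bound on the integrals of bounded functions. It comes
from `1 - ρ ≤ |log ρ|` for the ratio `ρ` of the densities. -/
lemma lintegral_noise_shift_le {n : ℕ} {σ : ℝ} (hσ : 0 < σ) (a b : Vec n) {f : Vec n → ℝ≥0∞}
    (hf : Measurable f) {M : ℝ≥0∞} (hM : ∀ x, f x ≤ M) :
    ∫⁻ w, f (a + w) ∂noise n σ ≤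
      ∫⁻ w, f (b + w) ∂noise n σ + M * ENNReal.ofReal (min 1 (3 * ‖b - a‖ / σ)) := by
  rcases le_total 1 (3 * ‖b - a‖ / σ) with h1 | h1
  · rw [min_eq_left h1]
    calc ∫⁻ w, f (a + w) ∂noise n σ ≤ ∫⁻ _, M ∂noise n σ := lintegral_mono fun w => hM _
      _ = M * ENNReal.ofReal 1 := by simp
      _ ≤ _ := le_add_self
  rw [min_eq_right h1]
  set c : Vec n := b - a with hc
  -- `g (x - a)` bounds the absolute value of the logarithm of the ratio of the densities at `x`
  have hcn : ‖c‖ ≤ σ / 3 := by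
    rw [div_le_one hσ] at h1; linarith
  set g : Vec n → ℝ := fun x => |⟪c, x⟫| / σ ^ 2 + ‖c‖ ^ 2 / (2 * σ ^ 2) with hg
  have hgm : Measurable g := by rw [hg]; fun_prop
  have hpt : ∀ x : Vec n, ENNReal.ofReal (gaussDensity σ (x - a)) * f x ≤
      ENNReal.ofReal (gaussDensity σ (x - b)) * f x +
        M * (ENNReal.ofReal (gaussDensity σ (x - a)) * ENNReal.ofReal (g (x - a))) := by
    intro x
    have h2 : gaussDensity σ (x - a) ≤
        gaussDensity σ (x - b) + gaussDensity σ (x - a) * g (x - a) := by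
      have h3 : x - b = (x - a) - c := by rw [hc]; abel
      rw [h3, gaussDensity_sub hσ (x - a) c, hg]
      have h4 := Real.add_one_le_exp (⟪c, x - a⟫ / σ ^ 2 - ‖c‖ ^ 2 / (2 * σ ^ 2))
      have h5 : -(|⟪c, x - a⟫| / σ ^ 2) ≤ ⟪c, x - a⟫ / σ ^ 2 := by
        rw [← neg_div]
        gcongr
        exact neg_abs_le _
      have h6 := gaussDensity_nonneg σ (x - a)
      have h7 : 1 ≤ Real.exp (⟪c, x - a⟫ / σ ^ 2 - ‖c‖ ^ 2 / (2 * σ ^ 2)) +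
        (|⟪c, x - a⟫| / σ ^ 2 + ‖c‖ ^ 2 / (2 * σ ^ 2)) := by linarith
      have h8 := mul_le_mul_of_nonneg_left h7 h6
      linarith
    have hg0 : 0 ≤ g (x - a) := by rw [hg]; positivity
    calc ENNReal.ofReal (gaussDensity σ (x - a)) * f x
        ≤ ENNReal.ofReal (gaussDensity σ (x - b) + gaussDensity σ (x - a) * g (x - a)) * f x := by
          gcongr
      _ = ENNReal.ofReal (gaussDensity σ (x - b)) * f x +
          f x * (ENNReal.ofReal (gaussDensity σ (x - a)) * ENNReal.ofReal (g (x - a))) := by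
          rw [ENNReal.ofReal_add (gaussDensity_nonneg _ _)
            (mul_nonneg (gaussDensity_nonneg _ _) hg0), add_mul,
            ENNReal.ofReal_mul (gaussDensity_nonneg _ _), mul_comm (f x)]
      _ ≤ _ := by gcongr; exact hM x
  rw [lintegral_noise_shift hσ a hf, lintegral_noise_shift hσ b hf]
  refine (lintegral_mono hpt).trans ?_
  rw [lintegral_add_left (by fun_prop), lintegral_const_mul _ (by fun_prop)]
  gcongr
  rw [lintegral_sub_right_eq_self
    (fun x => ENNReal.ofReal (gaussDensity σ x) * ENNReal.ofReal (g x)) a,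
    ← lintegral_noise hσ (by fun_prop)]
  have h8 : ∀ x, ENNReal.ofReal (g x) = ENNReal.ofReal (σ ^ 2)⁻¹ * ENNReal.ofReal |⟪c, x⟫| +
      ENNReal.ofReal (‖c‖ ^ 2 / (2 * σ ^ 2)) := by
    intro x
    rw [hg, ENNReal.ofReal_add (by positivity) (by positivity),
      ← ENNReal.ofReal_mul (by positivity)]
    congr 2
    field_simp
  simp_rw [h8]
  rw [lintegral_add_right _ (by fun_prop), lintegral_const_mul _ (by fun_prop), lintegral_const,
    measure_univ, mul_one]
  calc _ ≤ ENNReal.ofReal (σ ^ 2)⁻¹ * ENNReal.ofReal (2 * σ * ‖c‖) +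
        ENNReal.ofReal (‖c‖ ^ 2 / (2 * σ ^ 2)) := by
        gcongr; exact lintegral_abs_inner_noise_le hσ c
    _ = ENNReal.ofReal ((σ ^ 2)⁻¹ * (2 * σ * ‖c‖) + ‖c‖ ^ 2 / (2 * σ ^ 2)) := by
        rw [ENNReal.ofReal_add (by positivity) (by positivity),
          ENNReal.ofReal_mul (p := (σ ^ 2)⁻¹) (by positivity)]
    _ ≤ _ := by
        apply ENNReal.ofReal_le_ofReal
        rw [← sub_nonneg]
        have : 3 * ‖c‖ / σ - ((σ ^ 2)⁻¹ * (2 * σ * ‖c‖) + ‖c‖ ^ 2 / (2 * σ ^ 2)) =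
          ‖c‖ * (2 * σ - ‖c‖) / (2 * σ ^ 2) := by field_simp; ring
        rw [this]
        have : 0 ≤ 2 * σ - ‖c‖ := by linarith
        positivity

/-! ### The law of an episode -/

attribute [instance] Policy.isMarkov

section History

variable {dx dφ : ℕ} {U : Type}

lemma stepMap_castSucc (A : Matrix (Fin dx) (Fin dφ) ℝ) (φ : Vec dx → U → Vec dφ) {h : ℕ}
    (p : (Hist dx U h × U) × Vec dx) (k : Fin h) :
    (stepMap A φ h p).1 k.castSucc = p.1.1.1 k := by
  simp [stepMap]

lemma stepMap_last (A : Matrix (Fin dx) (Fin dφ) ℝ) (φ : Vec dx → U → Vec dφ) {h : ℕ}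
    (p : (Hist dx U h × U) × Vec dx) :
    (stepMap A φ h p).1 (Fin.last h) = (p.1.1.2, p.1.2) := by
  simp [stepMap]

lemma nextState_stepMap_castSucc (A : Matrix (Fin dx) (Fin dφ) ℝ) (φ : Vec dx → U → Vec dφ)
    {h : ℕ} (p : (Hist dx U h × U) × Vec dx) (k : Fin h) :
    nextState (stepMap A φ h p) k.castSucc = nextState p.1.1 k := by
  have hk : k.castSucc.val + 1 < h + 1 := by simp
  unfold nextState
  rw [dif_pos hk]
  split_ifs with h1
  · exact congrArg Prod.fst (stepMap_castSucc A φ p ⟨k + 1, h1⟩)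
  · have h2 : (⟨k.castSucc.val + 1, hk⟩ : Fin (h + 1)) = Fin.last h := by
      ext
      simp only [Fin.val_castSucc, Fin.val_last]
      omega
    rw [h2, stepMap_last]

lemma nextState_stepMap_last (A : Matrix (Fin dx) (Fin dφ) ℝ) (φ : Vec dx → U → Vec dφ)
    {h : ℕ} (p : (Hist dx U h × U) × Vec dx) :
    nextState (stepMap A φ h p) (Fin.last h) = A.toEuclideanLin (φ p.1.1.2 p.1.2) + p.2 := by
  simp [nextState, stepMap]

end History

section Episode

variable {dx dφ : ℕ} {U : Type} [MeasurableSpace U]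

@[fun_prop]
lemma measurable_toEuclideanLin (A : Matrix (Fin dx) (Fin dφ) ℝ) :
    Measurable (A.toEuclideanLin : Vec dφ → Vec dx) :=
  (LinearMap.continuous_of_finiteDimensional A.toEuclideanLin).measurable

lemma measurable_snoc {α : Type*} [MeasurableSpace α] (n : ℕ) :
    Measurable fun p : (Fin n → α) × α =>
      (Fin.snoc (α := fun _ => α) p.1 p.2 : Fin (n + 1) → α) := by
  refine measurable_pi_iff.2 fun i => ?_
  induction i using Fin.lastCases with
  | last => simpa using measurable_snd
  | cast i =>
    simp only [Fin.snoc_castSucc]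
    fun_prop

lemma measurable_feature {φ : Vec dx → U → Vec dφ} (hφ : Measurable (Function.uncurry φ))
    {h : ℕ} (k : Fin h) : Measurable fun τ : Hist dx U h => φ (τ.1 k).1 (τ.1 k).2 :=
  hφ.comp (by fun_prop : Measurable fun τ : Hist dx U h => ((τ.1 k).1, (τ.1 k).2))

lemma measurable_stepMap (A : Matrix (Fin dx) (Fin dφ) ℝ) {φ : Vec dx → U → Vec dφ}
    (hφ : Measurable (Function.uncurry φ)) (h : ℕ) : Measurable (stepMap A φ h) := by
  have h1 : Measurable fun p : (Hist dx U h × U) × Vec dx => φ p.1.1.2 p.1.2 :=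
    hφ.comp (by fun_prop : Measurable fun p : (Hist dx U h × U) × Vec dx => (p.1.1.2, p.1.2))
  unfold stepMap
  refine Measurable.prodMk ((measurable_snoc h).comp
    (by fun_prop : Measurable fun p : (Hist dx U h × U) × Vec dx =>
      (p.1.1.1, (p.1.1.2, p.1.2)))) ?_
  exact ((measurable_toEuclideanLin A).comp h1).add measurable_snd

lemma isProbabilityMeasure_trajLaw (σ : ℝ) (x₁ : Vec dx) {φ : Vec dx → U → Vec dφ}
    (hφ : Measurable (Function.uncurry φ)) (A : Matrix (Fin dx) (Fin dφ) ℝ) (π : Policy dx U)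
    (h : ℕ) : IsProbabilityMeasure (trajLaw σ x₁ φ A π h) := by
  induction h with
  | zero => unfold trajLaw; infer_instance
  | succ h ih =>
    unfold trajLaw
    exact Measure.isProbabilityMeasure_map (measurable_stepMap A hφ h).aemeasurable

lemma lintegral_trajLaw_succ (σ : ℝ) (x₁ : Vec dx) {φ : Vec dx → U → Vec dφ}
    (hφ : Measurable (Function.uncurry φ)) (A : Matrix (Fin dx) (Fin dφ) ℝ) (π : Policy dx U)
    (h : ℕ) {f : Hist dx U (h + 1) → ℝ≥0∞} (hf : Measurable f) :
    ∫⁻ τ, f τ ∂trajLaw σ x₁ φ A π (h + 1) =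
      ∫⁻ p, ∫⁻ u, ∫⁻ w, f (stepMap A φ h ((p, u), w)) ∂noise dx σ ∂π.act h p
        ∂trajLaw σ x₁ φ A π h := by
  have := isProbabilityMeasure_trajLaw σ x₁ hφ A π h
  have hm : Measurable fun p => f (stepMap A φ h p) := hf.comp (measurable_stepMap A hφ h)
  rw [trajLaw, lintegral_map hf (measurable_stepMap A hφ h), lintegral_prod _ hm.aemeasurable,
    Measure.lintegral_compProd hm.lintegral_prod_right']

@[fun_prop]
lemma measurable_nextState {h : ℕ} (k : Fin h) :
    Measurable fun τ : Hist dx U h => nextState τ k := by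
  unfold nextState
  split_ifs <;> fun_prop

/-- A bound on the total variation distance between the laws of the next state, after the input
`u` in the state `x`, on two systems whose parameters differ by `D`. -/
noncomputable def stepDist (σ : ℝ) (φ : Vec dx → U → Vec dφ) (D : Matrix (Fin dx) (Fin dφ) ℝ)
    (x : Vec dx) (u : U) : ℝ≥0∞ :=
  ENNReal.ofReal (min 1 (3 * ‖D.toEuclideanLin (φ x u)‖ / σ))

lemma measurable_stepDist (σ : ℝ) {φ : Vec dx → U → Vec dφ}
    (hφ : Measurable (Function.uncurry φ)) (D : Matrix (Fin dx) (Fin dφ) ℝ) :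
    Measurable (Function.uncurry (stepDist σ φ D)) := by
  have h1 : Measurable fun q : Vec dx × U => D.toEuclideanLin (φ q.1 q.2) :=
    (measurable_toEuclideanLin _).comp hφ
  have h2 : Measurable fun q : Vec dx × U =>
    ENNReal.ofReal (min 1 (3 * ‖D.toEuclideanLin (φ q.1 q.2)‖ / σ)) := by fun_prop
  exact h2

/-- The simulation lemma: the laws of an episode on two systems are compared step by step. The
error is an expectation over the trajectories of the first system. -/
lemma lintegral_trajLaw_le {σ : ℝ} (hσ : 0 < σ) (x₁ : Vec dx) {φ : Vec dx → U → Vec dφ}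
    (hφ : Measurable (Function.uncurry φ)) (A A' : Matrix (Fin dx) (Fin dφ) ℝ) (π : Policy dx U)
    (h : ℕ) {f : Hist dx U h → ℝ≥0∞} (hf : Measurable f) {M : ℝ≥0∞} (hM : ∀ τ, f τ ≤ M) :
    ∫⁻ τ, f τ ∂trajLaw σ x₁ φ A π h ≤ ∫⁻ τ, f τ ∂trajLaw σ x₁ φ A' π h +
      M * ∫⁻ τ, ∑ k : Fin h, stepDist σ φ (A' - A) (τ.1 k).1 (τ.1 k).2
        ∂trajLaw σ x₁ φ A π h := by
  have hψm := measurable_stepDist σ hφ (A' - A)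
  have hψτ : ∀ {h : ℕ} (k : Fin h), Measurable fun τ : Hist dx U h =>
      stepDist σ φ (A' - A) (τ.1 k).1 (τ.1 k).2 :=
    fun k => hψm.comp (by fun_prop : Measurable fun τ : Hist dx U _ => ((τ.1 k).1, (τ.1 k).2))
  -- only the last step uses what the error of a step is
  generalize hψ : stepDist σ φ (A' - A) = ψ at *
  induction h with
  | zero => simp [trajLaw]
  | succ h ih =>
    have hP := isProbabilityMeasure_trajLaw σ x₁ hφ A π h
    have hψs : Measurable fun τ : Hist dx U (h + 1) => ∑ k : Fin (h + 1), ψ (τ.1 k).1 (τ.1 k).2 :=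
      Finset.measurable_sum _ fun k _ => hψτ k
    rw [lintegral_trajLaw_succ σ x₁ hφ A π h hf, lintegral_trajLaw_succ σ x₁ hφ A' π h hf,
      lintegral_trajLaw_succ σ x₁ hφ A π h hψs]
    have hm : ∀ B : Matrix (Fin dx) (Fin dφ) ℝ, Measurable fun p : Hist dx U h × U =>
        ∫⁻ w, f (stepMap B φ h (p, w)) ∂noise dx σ := fun B =>
      (hf.comp (measurable_stepMap B hφ h)).lintegral_prod_right'
    have hmk : ∀ B : Matrix (Fin dx) (Fin dφ) ℝ, Measurable fun p : Hist dx U h =>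
        ∫⁻ u, ∫⁻ w, f (stepMap B φ h ((p, u), w)) ∂noise dx σ ∂π.act h p := fun B =>
      (hm B).lintegral_kernel_prod_right'
    have hψu : Measurable fun p : Hist dx U h × U => ψ p.1.2 p.2 :=
      hψm.comp ((measurable_snd.comp measurable_fst).prodMk measurable_snd)
    have hψp : Measurable fun p : Hist dx U h => ∫⁻ u, ψ p.2 u ∂π.act h p :=
      hψu.lintegral_kernel_prod_right'
    -- one step from the same history
    have hstep : ∀ p : Hist dx U h,
        ∫⁻ u, ∫⁻ w, f (stepMap A φ h ((p, u), w)) ∂noise dx σ ∂π.act h p ≤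
          ∫⁻ u, ∫⁻ w, f (stepMap A' φ h ((p, u), w)) ∂noise dx σ ∂π.act h p +
            M * ∫⁻ u, ψ p.2 u ∂π.act h p := by
      intro p
      have hψ1 : Measurable fun u => ψ p.2 u := hψu.comp measurable_prodMk_left
      rw [← lintegral_const_mul _ hψ1, ← lintegral_add_right _ (hψ1.const_mul _)]
      refine lintegral_mono fun u => ?_
      have hg : Measurable fun x : Vec dx =>
          f (Fin.snoc (α := fun _ => Vec dx × U) p.1 (p.2, u), x) := hf.comp measurable_prodMk_left
      have := lintegral_noise_shift_le hσ (A.toEuclideanLin (φ p.2 u))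
        (A'.toEuclideanLin (φ p.2 u)) hg (fun x => hM _)
      rw [← LinearMap.sub_apply, ← map_sub] at this
      rw [← hψ]
      exact this
    have hsum : ∀ (p : Hist dx U h) u, ∫⁻ w, ∑ k : Fin (h + 1),
        ψ ((stepMap A φ h ((p, u), w)).1 k).1 ((stepMap A φ h ((p, u), w)).1 k).2 ∂noise dx σ =
        (∑ k : Fin h, ψ (p.1 k).1 (p.1 k).2) + ψ p.2 u := by
      intro p u
      simp_rw [Fin.sum_univ_castSucc, stepMap_castSucc, stepMap_last]
      simp
    simp_rw [hsum]
    have hsum2 : ∀ p : Hist dx U h, ∫⁻ u, ((∑ k : Fin h, ψ (p.1 k).1 (p.1 k).2) + ψ p.2 u)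
        ∂π.act h p = (∑ k : Fin h, ψ (p.1 k).1 (p.1 k).2) + ∫⁻ u, ψ p.2 u ∂π.act h p := by
      intro p
      rw [lintegral_add_left measurable_const]
      simp
    simp_rw [hsum2]
    rw [lintegral_add_right _ hψp, mul_add, ← add_assoc]
    calc _ ≤ ∫⁻ p, (∫⁻ u, ∫⁻ w, f (stepMap A' φ h ((p, u), w)) ∂noise dx σ ∂π.act h p +
            M * ∫⁻ u, ψ p.2 u ∂π.act h p) ∂trajLaw σ x₁ φ A π h := lintegral_mono hstep
      _ = ∫⁻ p, ∫⁻ u, ∫⁻ w, f (stepMap A' φ h ((p, u), w)) ∂noise dx σ ∂π.act h p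
            ∂trajLaw σ x₁ φ A π h +
          M * ∫⁻ p, ∫⁻ u, ψ p.2 u ∂π.act h p ∂trajLaw σ x₁ φ A π h := by
          rw [lintegral_add_left (hmk A'), lintegral_const_mul _ hψp]
      _ ≤ _ := by
          gcongr
          refine ih (hmk A') fun p => ?_
          calc _ ≤ ∫⁻ _, ∫⁻ _, M ∂noise dx σ ∂π.act h p :=
                lintegral_mono fun u => lintegral_mono fun w => hM _
            _ = M := by simp

/-- The part of the state after step `k` that the system with parameter `A` does not predict. -/
noncomputable def residual (A : Matrix (Fin dx) (Fin dφ) ℝ) (φ : Vec dx → U → Vec dφ) {h : ℕ}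
    (τ : Hist dx U h) (k : Fin h) : Vec dx :=
  nextState τ k - A.toEuclideanLin (φ (τ.1 k).1 (τ.1 k).2)

lemma measurable_residual (A : Matrix (Fin dx) (Fin dφ) ℝ) {φ : Vec dx → U → Vec dφ}
    (hφ : Measurable (Function.uncurry φ)) {h : ℕ} (k : Fin h) :
    Measurable fun τ : Hist dx U h => residual A φ τ k :=
  (measurable_nextState k).sub ((measurable_toEuclideanLin A).comp (measurable_feature hφ k))

/-- The exponent of the exponential supermartingale of the self-normalized bound. -/
noncomputable def expTerm (σ : ℝ) (v x : Vec dx) (θ y : Vec dφ) : ℝ :=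
  ⟪y, θ⟫ * ⟪v, x⟫ / σ - ⟪y, θ⟫ ^ 2 / 2

lemma lintegral_expTerm_noise_le {σ : ℝ} (hσ : 0 < σ) {v : Vec dx} (hv : ‖v‖ ≤ 1)
    (θ y : Vec dφ) :
    ∫⁻ w, ENNReal.ofReal (Real.exp (expTerm σ v w θ y)) ∂noise dx σ ≤ 1 := by
  set c : ℝ := ⟪y, θ⟫ with hc
  have h1 : ∀ w, ENNReal.ofReal (Real.exp (expTerm σ v w θ y)) =
      ENNReal.ofReal (Real.exp (-(c ^ 2 / 2))) *
        ENNReal.ofReal (Real.exp ⟪(c / σ) • v, w⟫) := by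
    intro w
    rw [← ENNReal.ofReal_mul (Real.exp_pos _).le, ← Real.exp_add, expTerm, inner_smul_left]
    simp only [conj_trivial, ← hc]
    congr 2
    ring
  simp_rw [h1]
  rw [lintegral_const_mul _ (by fun_prop), lintegral_exp_inner_noise hσ,
    ← ENNReal.ofReal_mul (Real.exp_pos _).le, ← Real.exp_add, ← ENNReal.ofReal_one]
  apply ENNReal.ofReal_le_ofReal
  rw [Real.exp_le_one_iff, norm_smul, mul_pow, Real.norm_eq_abs, sq_abs]
  have h2 : -(c ^ 2 / 2) + σ ^ 2 * ((c / σ) ^ 2 * ‖v‖ ^ 2) / 2 = -(c ^ 2 / 2) * (1 - ‖v‖ ^ 2) := by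
    field_simp
    ring
  rw [h2]
  have h3 : ‖v‖ ^ 2 ≤ 1 := pow_le_one₀ (norm_nonneg v) hv
  nlinarith [sq_nonneg c]

lemma measurable_expTerm_residual (σ : ℝ) (A : Matrix (Fin dx) (Fin dφ) ℝ)
    {φ : Vec dx → U → Vec dφ} (hφ : Measurable (Function.uncurry φ)) {h : ℕ} (k : Fin h) :
    Measurable fun q : Hist dx U h × Vec dx × Vec dφ =>
      expTerm σ q.2.1 (residual A φ q.1 k) q.2.2 (φ (q.1.1 k).1 (q.1.1 k).2) := by
  have h1 : Measurable fun q : Hist dx U h × Vec dx × Vec dφ => residual A φ q.1 k :=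
    (measurable_residual A hφ k).comp measurable_fst
  have h2 : Measurable fun q : Hist dx U h × Vec dx × Vec dφ => φ (q.1.1 k).1 (q.1.1 k).2 :=
    (measurable_feature hφ k).comp measurable_fst
  unfold expTerm
  fun_prop

/-- The exponential supermartingale along an episode. -/
lemma lintegral_trajLaw_exp_le {σ : ℝ} (hσ : 0 < σ) (x₁ : Vec dx) {φ : Vec dx → U → Vec dφ}
    (hφ : Measurable (Function.uncurry φ)) (A : Matrix (Fin dx) (Fin dφ) ℝ) (π : Policy dx U)
    {v : Vec dx} (hv : ‖v‖ ≤ 1) (θ : Vec dφ) (h : ℕ) :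
    ∫⁻ τ, ∏ k : Fin h, ENNReal.ofReal (Real.exp
      (expTerm σ v (residual A φ τ k) θ (φ (τ.1 k).1 (τ.1 k).2))) ∂trajLaw σ x₁ φ A π h ≤ 1 := by
  have hm : ∀ {h : ℕ} (k : Fin h), Measurable fun τ : Hist dx U h => ENNReal.ofReal (Real.exp
      (expTerm σ v (residual A φ τ k) θ (φ (τ.1 k).1 (τ.1 k).2))) := fun k =>
    ((measurable_expTerm_residual σ A hφ k).comp
      (measurable_prodMk_right (y := (v, θ)))).exp.ennreal_ofReal
  induction h with
  | zero => simp [trajLaw]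
  | succ h ih =>
    rw [lintegral_trajLaw_succ σ x₁ hφ A π h (Finset.measurable_prod _ fun k _ => hm k)]
    refine (lintegral_mono fun p => ?_).trans ih
    calc _ ≤ ∫⁻ _, ∏ k : Fin h, ENNReal.ofReal (Real.exp
          (expTerm σ v (residual A φ p k) θ (φ (p.1 k).1 (p.1 k).2))) ∂π.act h p := by
          refine lintegral_mono fun u => ?_
          simp_rw [Fin.prod_univ_castSucc, residual, nextState_stepMap_castSucc,
            nextState_stepMap_last, stepMap_castSucc, stepMap_last, add_sub_cancel_left]
          rw [lintegral_const_mul _ (by unfold expTerm; fun_prop)]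
          exact mul_le_of_le_one_right' (lintegral_expTerm_noise_le hσ hv θ _)
      _ = _ := by simp

end Episode

/-! ### The law of the run -/

section Run

variable {dx dφ : ℕ} {U : Type} [MeasurableSpace U] {H : ℕ}

lemma measurable_trajLaw (σ : ℝ) (x₁ : Vec dx) {φ : Vec dx → U → Vec dφ}
    (hφ : Measurable (Function.uncurry φ)) (A : Matrix (Fin dx) (Fin dφ) ℝ)
    {L : Learner dx U H} (hL : L.IsMeasurable) (t h : ℕ) :
    Measurable fun d : Fin t → Hist dx U H => trajLaw σ x₁ φ A (L t d) h := by
  induction h with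
  | zero => exact measurable_const
  | succ h ih =>
    set κ : Kernel (Fin t → Hist dx U H) (Hist dx U h) :=
      ⟨fun d => trajLaw σ x₁ φ A (L t d) h, ih⟩ with hκ
    have : IsMarkovKernel κ := ⟨fun d => isProbabilityMeasure_trajLaw σ x₁ hφ A (L t d) h⟩
    set η : Kernel ((Fin t → Hist dx U H) × Hist dx U h) U :=
      ⟨fun p => (L t p.1).act h p.2, hL t h⟩ with hη
    have : IsMarkovKernel η := ⟨fun p => ((L t p.1).isMarkov h).isProbabilityMeasure p.2⟩
    have h1 : (fun d : Fin t → Hist dx U H => trajLaw σ x₁ φ A (L t d) (h + 1)) =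
        ⇑(((κ ⊗ₖ η) ×ₖ Kernel.const _ (noise dx σ)).map (stepMap A φ h)) := by
      funext d
      rw [Kernel.map_apply _ (measurable_stepMap A hφ h), Kernel.prod_apply, Kernel.const_apply,
        Kernel.compProd_apply_eq_compProd_sectR, trajLaw]
      rfl
    rw [h1]
    exact Kernel.measurable _

/-- The law of the trajectory of the next episode, as a kernel from the past episodes. -/
noncomputable def episodeKernel (σ : ℝ) (x₁ : Vec dx) {φ : Vec dx → U → Vec dφ}
    (hφ : Measurable (Function.uncurry φ)) (A : Matrix (Fin dx) (Fin dφ) ℝ)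
    {L : Learner dx U H} (hL : L.IsMeasurable) (t : ℕ) :
    Kernel (Fin t → Hist dx U H) (Hist dx U H) :=
  ⟨fun d => trajLaw σ x₁ φ A (L t d) H, measurable_trajLaw σ x₁ hφ A hL t H⟩

instance isMarkovKernel_episodeKernel (σ : ℝ) (x₁ : Vec dx) {φ : Vec dx → U → Vec dφ}
    (hφ : Measurable (Function.uncurry φ)) (A : Matrix (Fin dx) (Fin dφ) ℝ)
    {L : Learner dx U H} (hL : L.IsMeasurable) (t : ℕ) :
    IsMarkovKernel (episodeKernel σ x₁ hφ A hL t) :=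
  ⟨fun d => isProbabilityMeasure_trajLaw σ x₁ hφ A (L t d) H⟩

lemma measurable_snoc_left {α : Type*} [MeasurableSpace α] {t : ℕ} (d : Fin t → α) :
    Measurable fun a : α => (Fin.snoc (α := fun _ => α) d a : Fin (t + 1) → α) :=
  (measurable_snoc t).comp measurable_prodMk_left

lemma measurable_lintegral_trajLaw (σ : ℝ) (x₁ : Vec dx) {φ : Vec dx → U → Vec dφ}
    (hφ : Measurable (Function.uncurry φ)) (A : Matrix (Fin dx) (Fin dφ) ℝ)
    {L : Learner dx U H} (hL : L.IsMeasurable) (t : ℕ)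
    {f : (Fin t → Hist dx U H) × Hist dx U H → ℝ≥0∞} (hf : Measurable f) :
    Measurable fun d => ∫⁻ τ, f (d, τ) ∂trajLaw σ x₁ φ A (L t d) H :=
  hf.lintegral_kernel_prod_right' (κ := episodeKernel σ x₁ hφ A hL t)

lemma measurable_map_snoc_trajLaw (σ : ℝ) (x₁ : Vec dx) {φ : Vec dx → U → Vec dφ}
    (hφ : Measurable (Function.uncurry φ)) (A : Matrix (Fin dx) (Fin dφ) ℝ)
    {L : Learner dx U H} (hL : L.IsMeasurable) (t : ℕ) :
    Measurable fun d : Fin t → Hist dx U H => (trajLaw σ x₁ φ A (L t d) H).map fun τ =>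
      (Fin.snoc (α := fun _ => Hist dx U H) d τ : Fin (t + 1) → Hist dx U H) := by
  refine Measure.measurable_of_measurable_coe _ fun s hs => ?_
  have hs' := (measurable_snoc (α := Hist dx U H) t) hs
  have := Kernel.measurable_kernel_prodMk_left (κ := episodeKernel σ x₁ hφ A hL t) hs'
  convert! this using 2 with d
  rw [Measure.map_apply (measurable_snoc_left d) hs]
  rfl

lemma lintegral_runLaw_succ (σ : ℝ) (x₁ : Vec dx) {φ : Vec dx → U → Vec dφ}
    (hφ : Measurable (Function.uncurry φ)) (A : Matrix (Fin dx) (Fin dφ) ℝ)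
    {L : Learner dx U H} (hL : L.IsMeasurable) (t : ℕ)
    {f : (Fin (t + 1) → Hist dx U H) → ℝ≥0∞} (hf : Measurable f) :
    ∫⁻ d, f d ∂runLaw σ x₁ φ A L (t + 1) =
      ∫⁻ d, ∫⁻ τ, f (Fin.snoc (α := fun _ => Hist dx U H) d τ) ∂trajLaw σ x₁ φ A (L t d) H
        ∂runLaw σ x₁ φ A L t := by
  rw [runLaw, Measure.lintegral_bind (measurable_map_snoc_trajLaw σ x₁ hφ A hL t).aemeasurable
    hf.aemeasurable]
  refine lintegral_congr fun d => ?_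
  rw [lintegral_map hf (measurable_snoc_left d)]

lemma isProbabilityMeasure_runLaw (σ : ℝ) (x₁ : Vec dx) {φ : Vec dx → U → Vec dφ}
    (hφ : Measurable (Function.uncurry φ)) (A : Matrix (Fin dx) (Fin dφ) ℝ)
    {L : Learner dx U H} (hL : L.IsMeasurable) (t : ℕ) :
    IsProbabilityMeasure (runLaw σ x₁ φ A L t) := by
  induction t with
  | zero => unfold runLaw; infer_instance
  | succ t ih =>
    constructor
    have := lintegral_runLaw_succ σ x₁ hφ A hL t (f := fun _ => 1) measurable_const
    have hP := fun d => isProbabilityMeasure_trajLaw σ x₁ hφ A (L t d) H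
    simpa using this

/-- The episodes completed before episode `t`. -/
abbrev past {α : Type*} {T t : ℕ} (h : t ≤ T) (d : Fin T → α) : Fin t → α :=
  fun s => d (Fin.castLE h s)

lemma measurable_past {α : Type*} [MeasurableSpace α] {T t : ℕ} (h : t ≤ T) :
    Measurable (past h : (Fin T → α) → Fin t → α) :=
  measurable_pi_iff.2 fun _ => measurable_pi_apply _

lemma past_snoc {α : Type*} {T t : ℕ} (h : t ≤ T) (d : Fin T → α) (a : α) :
    past (h.trans (Nat.le_succ T)) (Fin.snoc (α := fun _ => α) d a : Fin (T + 1) → α) =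
      past h d := by
  funext s
  exact Fin.snoc_castSucc (α := fun _ => α) a d (Fin.castLE h s)

lemma past_self_snoc {α : Type*} {T : ℕ} (d : Fin T → α) (a : α) :
    past (Nat.le_succ T) (Fin.snoc (α := fun _ => α) d a : Fin (T + 1) → α) = d :=
  past_snoc le_rfl d a

lemma lintegral_runLaw_past (σ : ℝ) (x₁ : Vec dx) {φ : Vec dx → U → Vec dφ}
    (hφ : Measurable (Function.uncurry φ)) (A : Matrix (Fin dx) (Fin dφ) ℝ)
    {L : Learner dx U H} (hL : L.IsMeasurable) {T t : ℕ} (h : t ≤ T)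
    {f : (Fin t → Hist dx U H) → ℝ≥0∞} (hf : Measurable f) :
    ∫⁻ d, f (past h d) ∂runLaw σ x₁ φ A L T = ∫⁻ d, f d ∂runLaw σ x₁ φ A L t := by
  induction T, h using Nat.le_induction with
  | base => rfl
  | succ T h ih =>
    have hm : Measurable fun d : Fin (T + 1) → Hist dx U H =>
        f (past (h.trans (Nat.le_succ T)) d) :=
      hf.comp (measurable_past _)
    rw [lintegral_runLaw_succ σ x₁ hφ A hL T hm, ← ih]
    refine lintegral_congr fun d => ?_
    have hP := isProbabilityMeasure_trajLaw σ x₁ hφ A (L T d) H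
    simp_rw [past_snoc h d]
    simp

/-- The exponential supermartingale along a run. -/
lemma lintegral_runLaw_exp_le {σ : ℝ} (hσ : 0 < σ) (x₁ : Vec dx) {φ : Vec dx → U → Vec dφ}
    (hφ : Measurable (Function.uncurry φ)) (A : Matrix (Fin dx) (Fin dφ) ℝ)
    {L : Learner dx U H} (hL : L.IsMeasurable) {v : Vec dx} (hv : ‖v‖ ≤ 1) (θ : Vec dφ) (t : ℕ) :
    ∫⁻ d, ∏ s : Fin t, ∏ k : Fin H, ENNReal.ofReal (Real.exp (expTerm σ v (residual A φ (d s) k) θ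
      (φ ((d s).1 k).1 ((d s).1 k).2))) ∂runLaw σ x₁ φ A L t ≤ 1 := by
  have hm : Measurable fun τ : Hist dx U H => ∏ k : Fin H, ENNReal.ofReal (Real.exp
      (expTerm σ v (residual A φ τ k) θ (φ (τ.1 k).1 (τ.1 k).2))) :=
    Finset.measurable_prod _ fun k _ => ((measurable_expTerm_residual σ A hφ k).comp
      (measurable_prodMk_right (y := (v, θ)))).exp.ennreal_ofReal
  induction t with
  | zero => simp [runLaw]
  | succ t ih =>
    have hm2 : Measurable fun d : Fin (t + 1) → Hist dx U H => ∏ s : Fin (t + 1), ∏ k : Fin H,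
        ENNReal.ofReal (Real.exp (expTerm σ v (residual A φ (d s) k) θ
          (φ ((d s).1 k).1 ((d s).1 k).2))) :=
      Finset.measurable_prod _ fun s _ => hm.comp (measurable_pi_apply s)
    rw [lintegral_runLaw_succ σ x₁ hφ A hL t hm2]
    refine (lintegral_mono fun d => ?_).trans ih
    simp_rw [Fin.prod_univ_castSucc, Fin.snoc_castSucc, Fin.snoc_last]
    rw [lintegral_const_mul _ hm]
    exact mul_le_of_le_one_right' (lintegral_trajLaw_exp_le hσ x₁ hφ A (L t d) hv θ H)

end Run

/-! ### Regularized Gram matrices -/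

section Gram

variable {m n : ℕ} {ι : Type*} [Fintype ι]

lemma toEuclideanLin_mul {l : ℕ} (A : Matrix (Fin l) (Fin m) ℝ) (B : Matrix (Fin m) (Fin n) ℝ)
    (z : Vec n) : (A * B).toEuclideanLin z = A.toEuclideanLin (B.toEuclideanLin z) := by
  ext i
  simp

lemma toEuclideanLin_one (z : Vec n) :
    (1 : Matrix (Fin n) (Fin n) ℝ).toEuclideanLin z = z := by
  ext i
  simp

lemma toEuclideanLin_vecMulVec (x : Vec m) (y z : Vec n) :
    (Matrix.vecMulVec x.ofLp y.ofLp).toEuclideanLin z = ⟪y, z⟫ • x := by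
  ext i
  simp [Matrix.toLpLin_apply, Matrix.vecMulVec_mulVec, PiLp.inner_apply, dotProduct, mul_comm]

lemma inner_toEuclideanLin_left (A : Matrix (Fin m) (Fin n) ℝ) (x : Vec m) (y : Vec n) :
    ⟪A.toEuclideanLin y, x⟫ = ⟪y, A.transpose.toEuclideanLin x⟫ := by
  rw [← Matrix.conjTranspose_eq_transpose_of_trivial,
    Matrix.toEuclideanLin_conjTranspose_eq_adjoint, LinearMap.adjoint_inner_right]

lemma inner_toEuclideanLin_eq_sum (A : Matrix (Fin m) (Fin n) ℝ) (x : Vec m) (y : Vec n) :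
    ⟪x, A.toEuclideanLin y⟫ = ∑ j, ∑ k, Matrix.vecMulVec x.ofLp y.ofLp j k * A j k := by
  simp only [PiLp.inner_apply, Matrix.toLpLin_apply, Matrix.mulVec, dotProduct,
    Matrix.vecMulVec_apply, RCLike.inner_apply, conj_trivial, Finset.sum_mul]
  exact Finset.sum_congr rfl fun j _ => Finset.sum_congr rfl fun k _ => by ring

lemma norm_toEuclideanLin_le (A : Matrix (Fin m) (Fin n) ℝ) (x : Vec n) :
    ‖A.toEuclideanLin x‖ ≤ ‖A‖ * ‖x‖ :=
  A.l2_opNorm_mulVec x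

lemma norm_le_of_forall_unit (A : Matrix (Fin m) (Fin n) ℝ) {r : ℝ} (hr : 0 ≤ r)
    (h : ∀ u : Vec n, ‖u‖ = 1 → ‖A.toEuclideanLin u‖ ≤ r) : ‖A‖ ≤ r := by
  rw [Matrix.l2_opNorm_def]
  refine ContinuousLinearMap.opNorm_le_of_unit_norm hr fun u hu => ?_
  exact h u hu

/-- The regularized Gram matrix `λ I + ∑ᵢ yᵢ yᵢᵀ`. -/
noncomputable def gram (lam : ℝ) (y : ι → Vec n) : Matrix (Fin n) (Fin n) ℝ :=
  lam • 1 + ∑ i, Matrix.vecMulVec (y i).ofLp (y i).ofLp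

lemma posSemidef_vecMulVec (y : Vec n) : (Matrix.vecMulVec y.ofLp y.ofLp).PosSemidef := by
  simpa using Matrix.posSemidef_vecMulVec_self_star y.ofLp

lemma posDef_gram {lam : ℝ} (hlam : 0 < lam) (y : ι → Vec n) : (gram lam y).PosDef :=
  (Matrix.PosDef.one.smul hlam).add_posSemidef
    (Matrix.posSemidef_sum _ fun i _ => posSemidef_vecMulVec (y i))

lemma toEuclideanLin_gram (lam : ℝ) (y : ι → Vec n) (z : Vec n) :
    (gram lam y).toEuclideanLin z = lam • z + ∑ i, ⟪y i, z⟫ • y i := by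
  simp only [gram, map_add, map_smul, map_sum, LinearMap.add_apply, LinearMap.smul_apply,
    LinearMap.sum_apply, toEuclideanLin_vecMulVec, toEuclideanLin_one]

lemma inner_gram (lam : ℝ) (y : ι → Vec n) (z : Vec n) :
    ⟪z, (gram lam y).toEuclideanLin z⟫ = lam * ‖z‖ ^ 2 + ∑ i, ⟪y i, z⟫ ^ 2 := by
  rw [toEuclideanLin_gram, inner_add_right, inner_smul_right, real_inner_self_eq_norm_sq,
    inner_sum]
  congr 1
  refine Finset.sum_congr rfl fun i _ => ?_
  rw [inner_smul_right, real_inner_comm z]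
  ring

lemma sqrt_mul_sqrt {M : Matrix (Fin n) (Fin n) ℝ} (hM : M.PosDef) :
    CFC.sqrt M * CFC.sqrt M = M :=
  CFC.sqrt_mul_sqrt_self M hM.posSemidef.nonneg

lemma transpose_sqrt (M : Matrix (Fin n) (Fin n) ℝ) : (CFC.sqrt M).transpose = CFC.sqrt M := by
  have h := (Matrix.nonneg_iff_posSemidef.1 (CFC.sqrt_nonneg M)).isHermitian
  rwa [Matrix.IsHermitian, Matrix.conjTranspose_eq_transpose_of_trivial] at h

lemma det_sqrt_eq {M : Matrix (Fin n) (Fin n) ℝ} (hM : M.PosDef) :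
    (CFC.sqrt M).det = √M.det := by
  rw [hM.posSemidef.det_sqrt, RCLike.sqrt_of_nonneg hM.det_pos.le]
  simp

lemma isUnit_det_sqrt {M : Matrix (Fin n) (Fin n) ℝ} (hM : M.PosDef) :
    IsUnit (CFC.sqrt M).det := by
  rw [det_sqrt_eq hM]
  exact (Real.sqrt_pos.2 hM.det_pos).ne'.isUnit

lemma sqrt_inv_apply_sqrt {M : Matrix (Fin n) (Fin n) ℝ} (hM : M.PosDef) (z : Vec n) :
    (CFC.sqrt M).toEuclideanLin ((CFC.sqrt M)⁻¹.toEuclideanLin z) = z := by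
  rw [← toEuclideanLin_mul, Matrix.mul_nonsing_inv _ (isUnit_det_sqrt hM), toEuclideanLin_one]

lemma norm_sq_sqrt_apply {M : Matrix (Fin n) (Fin n) ℝ} (hM : M.PosDef) (z : Vec n) :
    ‖(CFC.sqrt M).toEuclideanLin z‖ ^ 2 = ⟪z, M.toEuclideanLin z⟫ := by
  rw [← real_inner_self_eq_norm_sq, inner_toEuclideanLin_left, transpose_sqrt,
    ← toEuclideanLin_mul, sqrt_mul_sqrt hM]

lemma norm_sq_sqrt_inv_apply {M : Matrix (Fin n) (Fin n) ℝ} (hM : M.PosDef) (z : Vec n) :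
    ‖(CFC.sqrt M)⁻¹.toEuclideanLin z‖ ^ 2 = ⟪z, M⁻¹.toEuclideanLin z⟫ := by
  rw [← real_inner_self_eq_norm_sq, inner_toEuclideanLin_left, Matrix.transpose_nonsing_inv,
    transpose_sqrt, ← toEuclideanLin_mul, ← Matrix.mul_inv_rev, sqrt_mul_sqrt hM]

lemma inner_inv_nonneg {M : Matrix (Fin n) (Fin n) ℝ} (hM : M.PosDef) (z : Vec n) :
    0 ≤ ⟪z, M⁻¹.toEuclideanLin z⟫ := by
  rw [← norm_sq_sqrt_inv_apply hM]
  positivity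

/-- The weighted norm `‖z‖_{M⁻¹}`. -/
noncomputable def invNorm (M : Matrix (Fin n) (Fin n) ℝ) (z : Vec n) : ℝ :=
  √⟪z, M⁻¹.toEuclideanLin z⟫

lemma invNorm_nonneg (M : Matrix (Fin n) (Fin n) ℝ) (z : Vec n) : 0 ≤ invNorm M z :=
  Real.sqrt_nonneg _

lemma norm_sqrt_inv_apply {M : Matrix (Fin n) (Fin n) ℝ} (hM : M.PosDef) (z : Vec n) :
    ‖(CFC.sqrt M)⁻¹.toEuclideanLin z‖ = invNorm M z := by
  rw [invNorm, ← norm_sq_sqrt_inv_apply hM, Real.sqrt_sq (norm_nonneg _)]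

lemma norm_apply_le_invNorm {M : Matrix (Fin n) (Fin n) ℝ} (hM : M.PosDef)
    (D : Matrix (Fin m) (Fin n) ℝ) (z : Vec n) :
    ‖D.toEuclideanLin z‖ ≤ ‖D * CFC.sqrt M‖ * invNorm M z := by
  have h := norm_toEuclideanLin_le (D * CFC.sqrt M) ((CFC.sqrt M)⁻¹.toEuclideanLin z)
  rwa [toEuclideanLin_mul, sqrt_inv_apply_sqrt hM, norm_sqrt_inv_apply hM] at h

lemma invNorm_gram_le {lam : ℝ} (hlam : 0 < lam) (y : ι → Vec n) (z : Vec n) :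
    invNorm (gram lam y) z ≤ ‖z‖ / √lam := by
  have hM := posDef_gram hlam y
  set R := CFC.sqrt (gram lam y)
  rw [← norm_sqrt_inv_apply hM]
  have h1 := norm_sq_sqrt_apply hM (R⁻¹.toEuclideanLin z)
  rw [sqrt_inv_apply_sqrt hM, inner_gram] at h1
  have h2 : 0 ≤ ∑ i, ⟪y i, R⁻¹.toEuclideanLin z⟫ ^ 2 := Finset.sum_nonneg fun _ _ => sq_nonneg _
  rw [le_div_iff₀ (Real.sqrt_pos.2 hlam)]
  refine le_of_sq_le_sq ?_ (norm_nonneg z)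
  rw [mul_pow, Real.sq_sqrt hlam.le, h1]
  linarith

lemma det_add_vecMulVec {M : Matrix (Fin n) (Fin n) ℝ} (hM : M.PosDef) (z : Vec n) :
    (M + Matrix.vecMulVec z.ofLp z.ofLp).det = M.det * (1 + invNorm M z ^ 2) := by
  rw [Matrix.vecMulVec_eq Unit, Matrix.det_add_mul _ _ hM.det_pos.ne'.isUnit,
    Matrix.det_unique (n := Unit),
    invNorm, Real.sq_sqrt (inner_inv_nonneg hM z), Matrix.add_apply, Matrix.one_apply_eq,
    Matrix.mul_assoc]
  congr 2
  simp [Matrix.mul_apply, PiLp.inner_apply, Matrix.toLpLin_apply, Matrix.mulVec, dotProduct,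
    mul_comm]

lemma det_le_det_add_sum {κ : Type*} {M : Matrix (Fin n) (Fin n) ℝ} (hM : M.PosDef)
    (y : κ → Vec n) (s : Finset κ) :
    M.det ≤ (M + ∑ i ∈ s, Matrix.vecMulVec (y i).ofLp (y i).ofLp).det := by
  classical
  induction s using Finset.induction_on with
  | empty => simp
  | insert i s hi ih =>
    have hN : (M + ∑ i ∈ s, Matrix.vecMulVec (y i).ofLp (y i).ofLp).PosDef :=
      hM.add_posSemidef (Matrix.posSemidef_sum _ fun i _ => posSemidef_vecMulVec (y i))
    rw [Finset.sum_insert hi, add_comm (Matrix.vecMulVec _ _), ← add_assoc, det_add_vecMulVec hN]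
    refine ih.trans (le_mul_of_one_le_right hN.det_pos.le ?_)
    linarith [sq_nonneg (invNorm (M + ∑ i ∈ s, Matrix.vecMulVec (y i).ofLp (y i).ofLp) (y i))]

/-- One step of the elliptical potential argument. Several rank-one terms are added at once, and
each of them alone makes the determinant grow this much. -/
lemma det_mul_le_det_add_sum {M : Matrix (Fin n) (Fin n) ℝ} (hM : M.PosDef) (y : ι → Vec n)
    (k : ι) :
    M.det * (1 + invNorm M (y k) ^ 2) ≤
      (M + ∑ i, Matrix.vecMulVec (y i).ofLp (y i).ofLp).det := by
  classical
  rw [← det_add_vecMulVec hM, ← Finset.add_sum_erase _ _ (Finset.mem_univ k), ← add_assoc]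
  exact det_le_det_add_sum (hM.add_posSemidef (posSemidef_vecMulVec (y k))) y _

lemma det_smul_one (lam : ℝ) : (lam • (1 : Matrix (Fin n) (Fin n) ℝ)).det = lam ^ n := by
  simp

lemma pow_le_det_gram {lam : ℝ} (hlam : 0 < lam) (y : ι → Vec n) :
    lam ^ n ≤ (gram lam y).det := by
  rw [← det_smul_one (n := n) lam]
  exact det_le_det_add_sum (Matrix.PosDef.one.smul hlam) y Finset.univ

/-- Every eigenvalue of the Gram matrix is at most `λ + K`. -/
lemma det_gram_le {lam : ℝ} (hlam : 0 < lam) (y : ι → Vec n) {K : ℝ}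
    (hK : ∑ i, ‖y i‖ ^ 2 ≤ K) : (gram lam y).det ≤ (lam + K) ^ n := by
  have hM := posDef_gram hlam y
  rw [hM.isHermitian.det_eq_prod_eigenvalues]
  calc ∏ i, hM.isHermitian.eigenvalues i ≤ ∏ _i : Fin n, (lam + K) := by
        refine Finset.prod_le_prod (fun i _ => hM.posSemidef.eigenvalues_nonneg i) fun i _ => ?_
        set u := hM.isHermitian.eigenvectorBasis i with hu
        have hu1 : ‖u‖ = 1 := hM.isHermitian.eigenvectorBasis.norm_eq_one i
        have h1 : hM.isHermitian.eigenvalues i = ⟪u, (gram lam y).toEuclideanLin u⟫ := by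
          rw [hM.isHermitian.eigenvalues_eq i]
          simp [PiLp.inner_apply, Matrix.toLpLin_apply, dotProduct, mul_comm, hu]
        rw [h1, inner_gram, hu1]
        have h2 : ∀ i, ⟪y i, u⟫ ^ 2 ≤ ‖y i‖ ^ 2 := fun i => by
          have := abs_real_inner_le_norm (y i) u
          rw [hu1, mul_one] at this
          exact sq_le_sq' (neg_le_of_abs_le this) (le_of_abs_le this)
        have := Finset.sum_le_sum fun i (_ : i ∈ Finset.univ) => h2 i
        linarith
    _ = (lam + K) ^ n := by simp

end Gram

/-! ### Ridge regression -/

section Ridge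

variable {m n : ℕ} {ι : Type*} [Fintype ι]

lemma sum_vecMulVec_residual (B : Matrix (Fin m) (Fin n) ℝ) (x : ι → Vec m) (y : ι → Vec n)
    (lam : ℝ) :
    ∑ i, Matrix.vecMulVec (x i - B.toEuclideanLin (y i)).ofLp (y i).ofLp =
      (∑ i, Matrix.vecMulVec (x i).ofLp (y i).ofLp) - B * gram lam y + lam • B := by
  have h : ∀ i, Matrix.vecMulVec (x i - B.toEuclideanLin (y i)).ofLp (y i).ofLp =
      Matrix.vecMulVec (x i).ofLp (y i).ofLp -
        B * Matrix.vecMulVec (y i).ofLp (y i).ofLp := by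
    intro i
    rw [Matrix.mul_vecMulVec, ← Matrix.sub_vecMulVec]
    rfl
  simp_rw [h, Finset.sum_sub_distrib, gram, Matrix.mul_add, Matrix.mul_sum, Matrix.mul_smul,
    Matrix.mul_one]
  abel

/-- At a solution `B` of the normal equations the ridge loss is an exact quadratic. -/
lemma ridge_eq_add {x : ι → Vec m} {y : ι → Vec n} {lam : ℝ} {B : Matrix (Fin m) (Fin n) ℝ}
    (hB : B * gram lam y = ∑ i, Matrix.vecMulVec (x i).ofLp (y i).ofLp)
    (A : Matrix (Fin m) (Fin n) ℝ) :
    (∑ i, ‖x i - A.toEuclideanLin (y i)‖ ^ 2) + lam * ∑ j, ∑ k, A j k ^ 2 =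
      (∑ i, ‖x i - B.toEuclideanLin (y i)‖ ^ 2) + lam * ∑ j, ∑ k, B j k ^ 2 +
        ((∑ i, ‖(A - B).toEuclideanLin (y i)‖ ^ 2) + lam * ∑ j, ∑ k, (A j k - B j k) ^ 2) := by
  have h1 : ∀ i, ‖x i - A.toEuclideanLin (y i)‖ ^ 2 = ‖x i - B.toEuclideanLin (y i)‖ ^ 2 +
      ‖(A - B).toEuclideanLin (y i)‖ ^ 2 -
        2 * ⟪x i - B.toEuclideanLin (y i), (A - B).toEuclideanLin (y i)⟫ := by
    intro i
    have : x i - A.toEuclideanLin (y i) =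
        (x i - B.toEuclideanLin (y i)) - (A - B).toEuclideanLin (y i) := by
      rw [map_sub, LinearMap.sub_apply]; abel
    rw [this, norm_sub_sq_real]
    ring
  have h2 : ∑ i, ⟪x i - B.toEuclideanLin (y i), (A - B).toEuclideanLin (y i)⟫ =
      lam * ∑ j, ∑ k, B j k * (A j k - B j k) := by
    have h3 := sum_vecMulVec_residual B x y lam
    rw [hB, sub_self, zero_add] at h3
    simp_rw [inner_toEuclideanLin_eq_sum]
    rw [Finset.sum_comm, Finset.mul_sum]
    refine Finset.sum_congr rfl fun j _ => ?_
    rw [Finset.sum_comm, Finset.mul_sum]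
    refine Finset.sum_congr rfl fun k _ => ?_
    rw [← Finset.sum_mul, ← mul_assoc, ← Matrix.sub_apply]
    congr 1
    rw [← Matrix.sum_apply, h3]
    rfl
  have h4 : ∑ j, ∑ k, A j k ^ 2 = ∑ j, ∑ k, B j k ^ 2 +
      2 * ∑ j, ∑ k, B j k * (A j k - B j k) + ∑ j, ∑ k, (A j k - B j k) ^ 2 := by
    simp_rw [Finset.mul_sum, ← Finset.sum_add_distrib]
    exact Finset.sum_congr rfl fun j _ => Finset.sum_congr rfl fun k _ => by ring
  simp_rw [h1]
  rw [Finset.sum_sub_distrib, Finset.sum_add_distrib, ← Finset.mul_sum, h2, h4]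
  ring

/-- The ridge loss has a unique minimizer, the solution of the normal equations. -/
lemma isMinOn_ridge_iff (x : ι → Vec m) (y : ι → Vec n) {lam : ℝ} (hlam : 0 < lam)
    (B : Matrix (Fin m) (Fin n) ℝ) :
    IsMinOn (fun A : Matrix (Fin m) (Fin n) ℝ =>
      (∑ i, ‖x i - A.toEuclideanLin (y i)‖ ^ 2) + lam * ∑ j, ∑ k, A j k ^ 2) Set.univ B ↔
      B * gram lam y = ∑ i, Matrix.vecMulVec (x i).ofLp (y i).ofLp := by
  constructor
  · intro hmin
    set B' := (∑ i, Matrix.vecMulVec (x i).ofLp (y i).ofLp) * (gram lam y)⁻¹ with hB'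
    have h1 : B' * gram lam y = ∑ i, Matrix.vecMulVec (x i).ofLp (y i).ofLp := by
      rw [hB', Matrix.mul_assoc, Matrix.nonsing_inv_mul _
        (posDef_gram hlam y).det_pos.ne'.isUnit, Matrix.mul_one]
    have h2 := isMinOn_univ_iff.1 hmin B'
    rw [ridge_eq_add h1 B] at h2
    have h3 : 0 ≤ ∑ i, ‖(B - B').toEuclideanLin (y i)‖ ^ 2 :=
      Finset.sum_nonneg fun _ _ => sq_nonneg _
    have h4 : ∑ j, ∑ k, (B j k - B' j k) ^ 2 ≤ 0 := by
      by_contra! h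
      nlinarith [mul_pos hlam h]
    have h5 : B = B' := by
      ext j k
      have h6 : (B j k - B' j k) ^ 2 ≤ ∑ j, ∑ k, (B j k - B' j k) ^ 2 :=
        (Finset.single_le_sum (f := fun k => (B j k - B' j k) ^ 2)
          (fun _ _ => sq_nonneg _) (Finset.mem_univ k)).trans
          (Finset.single_le_sum (f := fun j => ∑ k, (B j k - B' j k) ^ 2)
          (fun _ _ => Finset.sum_nonneg fun _ _ => sq_nonneg _) (Finset.mem_univ j))
      nlinarith [sq_nonneg (B j k - B' j k)]
    rw [h5, h1]
  · intro hB
    refine isMinOn_univ_iff.2 fun A => ?_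
    rw [ridge_eq_add hB A]
    have h3 : 0 ≤ ∑ i, ‖(A - B).toEuclideanLin (y i)‖ ^ 2 :=
      Finset.sum_nonneg fun _ _ => sq_nonneg _
    have h4 : 0 ≤ ∑ j, ∑ k, (A j k - B j k) ^ 2 :=
      Finset.sum_nonneg fun _ _ => Finset.sum_nonneg fun _ _ => sq_nonneg _
    have := mul_nonneg hlam.le h4
    linarith

/-- The error of the ridge estimate `B`, in the norm of the confidence set, splits into the bias of
the regularization and the self-normalized noise. -/
lemma norm_sub_ridge_mul_sqrt_le {x : ι → Vec m} {y : ι → Vec n} {lam : ℝ} (hlam : 0 < lam)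
    {B : Matrix (Fin m) (Fin n) ℝ}
    (hB : B * gram lam y = ∑ i, Matrix.vecMulVec (x i).ofLp (y i).ofLp)
    (A : Matrix (Fin m) (Fin n) ℝ) {b r : ℝ} (hA : ‖A‖ ≤ b)
    (hr : ∀ u : Vec n, ‖u‖ = 1 →
      ‖((∑ i, Matrix.vecMulVec (x i - A.toEuclideanLin (y i)).ofLp (y i).ofLp) *
        (CFC.sqrt (gram lam y))⁻¹).toEuclideanLin u‖ ≤ r) (hr0 : 0 ≤ r) :
    ‖(A - B) * CFC.sqrt (gram lam y)‖ ≤ √lam * b + r := by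
  have hM := posDef_gram hlam y
  have hb : 0 ≤ b := (norm_nonneg A).trans hA
  set S := ∑ i, Matrix.vecMulVec (x i - A.toEuclideanLin (y i)).ofLp (y i).ofLp with hS
  have h1 : (A - B) * CFC.sqrt (gram lam y) =
      (lam • A - S) * (CFC.sqrt (gram lam y))⁻¹ := by
    have h2 : lam • A - S = (A - B) * gram lam y := by
      rw [hS, sum_vecMulVec_residual A x y lam, ← hB, Matrix.sub_mul]
      abel
    rw [h2]
    nth_rw 2 [← sqrt_mul_sqrt hM]
    rw [Matrix.mul_assoc, Matrix.mul_assoc, Matrix.mul_nonsing_inv _ (isUnit_det_sqrt hM),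
      Matrix.mul_one]
  rw [h1]
  refine norm_le_of_forall_unit _ (by positivity) fun u hu => ?_
  rw [Matrix.sub_mul, map_sub, LinearMap.sub_apply]
  refine (norm_sub_le _ _).trans (add_le_add ?_ (hr u hu))
  rw [Matrix.smul_mul, map_smul, LinearMap.smul_apply, norm_smul, Real.norm_of_nonneg hlam.le,
    toEuclideanLin_mul]
  have h3 : ‖(CFC.sqrt (gram lam y))⁻¹.toEuclideanLin u‖ ≤ 1 / √lam := by
    rw [norm_sqrt_inv_apply hM, ← hu]
    exact invNorm_gram_le hlam y u
  calc lam * ‖A.toEuclideanLin ((CFC.sqrt (gram lam y))⁻¹.toEuclideanLin u)‖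
      ≤ lam * (b * (1 / √lam)) := by
        gcongr
        exact (norm_toEuclideanLin_le _ _).trans (by gcongr)
    _ = √lam * b := by
        have := Real.sqrt_pos.2 hlam
        field_simp
        rw [Real.sq_sqrt hlam.le, mul_comm]

end Ridge

/-! ### The method of mixtures -/

section Mixture

variable {m n : ℕ} {ι : Type*} [Fintype ι]

lemma det_toEuclideanLin (M : Matrix (Fin n) (Fin n) ℝ) :
    LinearMap.det (M.toEuclideanLin) = M.det := by
  exact LinearMap.det_toLin (PiLp.basisFun 2 ℝ (Fin n)) M

lemma lintegral_comp_toEuclideanLin {M : Matrix (Fin n) (Fin n) ℝ} (hM : 0 < M.det)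
    {g : Vec n → ℝ≥0∞} (hg : Measurable g) :
    ∫⁻ z, g (M.toEuclideanLin z) = ENNReal.ofReal M.det⁻¹ * ∫⁻ z, g z := by
  have h1 : LinearMap.det (M.toEuclideanLin) ≠ 0 := by
    rw [det_toEuclideanLin]; exact hM.ne'
  rw [← lintegral_map hg (measurable_toEuclideanLin M),
    Measure.map_linearMap_addHaar_eq_smul_addHaar _ h1, lintegral_smul_measure,
    det_toEuclideanLin, abs_of_pos (inv_pos.2 hM), smul_eq_mul]

lemma lintegral_gauss {b : ℝ} (hb : 0 < b) :
    ∫⁻ z : Vec n, ENNReal.ofReal (Real.exp (-b * ‖z‖ ^ 2)) =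
      ENNReal.ofReal ((Real.pi / b) ^ (n / 2 : ℝ)) := by
  rw [← ofReal_integral_eq_lintegral_ofReal (integrable_gauss hb)
    (.of_forall fun _ => (Real.exp_pos _).le),
    GaussianFourier.integral_rexp_neg_mul_sq_norm hb]
  simp

/-- The matrix `∑ᵢ wᵢ yᵢᵀ` of the self-normalized bound. -/
noncomputable def crossSum (w : ι → Vec m) (y : ι → Vec n) : Matrix (Fin m) (Fin n) ℝ :=
  ∑ i, Matrix.vecMulVec (w i).ofLp (y i).ofLp

lemma toEuclideanLin_crossSum (w : ι → Vec m) (y : ι → Vec n) (z : Vec n) :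
    (crossSum w y).toEuclideanLin z = ∑ i, ⟪y i, z⟫ • w i := by
  simp only [crossSum, map_sum, LinearMap.sum_apply, toEuclideanLin_vecMulVec]

lemma sum_expTerm (σ lam : ℝ) (w : ι → Vec m) (y : ι → Vec n) (v : Vec m) (θ : Vec n) :
    ∑ i, expTerm σ v (w i) θ (y i) = ⟪v, (crossSum w y).toEuclideanLin θ⟫ / σ -
      ⟪θ, (gram lam y).toEuclideanLin θ⟫ / 2 + lam * ‖θ‖ ^ 2 / 2 := by
  rw [inner_gram, toEuclideanLin_crossSum, inner_sum]
  simp_rw [inner_smul_right, expTerm, Finset.sum_sub_distrib, Finset.sum_div]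
  rw [add_div, Finset.sum_div]
  ring

/-- The product of the increments of the exponential supermartingale, mixed over `θ` with the law
`N(0, λ⁻¹ I)`. The Gaussian integral is computed exactly, by completing the square. -/
lemma lintegral_theta_mixture {σ lam : ℝ} (hlam : 0 < lam) (w : ι → Vec m)
    (y : ι → Vec n) (v : Vec m) :
    ∫⁻ θ, ∏ i, ENNReal.ofReal (Real.exp (expTerm σ v (w i) θ (y i))) ∂noise n (1 / √lam) =
      ENNReal.ofReal (√(lam ^ n / (gram lam y).det) * Real.exp
        (‖(CFC.sqrt (gram lam y))⁻¹.toEuclideanLin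
          ((crossSum w y).transpose.toEuclideanLin v)‖ ^ 2 / (2 * σ ^ 2))) := by
  have hM := posDef_gram hlam y
  set R := CFC.sqrt (gram lam y) with hR
  have hsl : 0 < √lam := Real.sqrt_pos.2 hlam
  have hb : 1 / (2 * (1 / √lam) ^ 2) = lam / 2 := by
    rw [div_pow, Real.sq_sqrt hlam.le]; field_simp
  have hRdet : 0 < R.det := by rw [hR, det_sqrt_eq hM]; exact Real.sqrt_pos.2 hM.det_pos
  set a : Vec n := (1 / σ) • R⁻¹.toEuclideanLin ((crossSum w y).transpose.toEuclideanLin v) with ha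
  have hmeas : Measurable fun θ : Vec n =>
      ∏ i, ENNReal.ofReal (Real.exp (expTerm σ v (w i) θ (y i))) := by
    unfold expTerm; fun_prop
  rw [lintegral_noise (by positivity) hmeas]
  have hpt : ∀ θ : Vec n, ENNReal.ofReal (gaussDensity (1 / √lam) θ) *
      ∏ i, ENNReal.ofReal (Real.exp (expTerm σ v (w i) θ (y i))) =
      ENNReal.ofReal ((∫ z : Vec n, Real.exp (-(lam / 2) * ‖z‖ ^ 2))⁻¹ * Real.exp (‖a‖ ^ 2 / 2)) *
        ENNReal.ofReal (Real.exp (-(1 / 2) * ‖R.toEuclideanLin θ - a‖ ^ 2)) := by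
    intro θ
    rw [← ENNReal.ofReal_prod_of_nonneg fun i _ => (Real.exp_pos _).le, ← Real.exp_sum,
      sum_expTerm σ lam, gaussDensity, hb, ← ENNReal.ofReal_mul (by positivity),
      ← ENNReal.ofReal_mul (by positivity), mul_assoc, mul_assoc, ← Real.exp_add, ← Real.exp_add]
    congr 3
    have h1 : ⟪v, (crossSum w y).toEuclideanLin θ⟫ / σ = ⟪R.toEuclideanLin θ, a⟫ := by
      rw [ha, inner_smul_right, inner_toEuclideanLin_left, ← toEuclideanLin_mul, hR,
        transpose_sqrt, Matrix.mul_nonsing_inv _ (isUnit_det_sqrt hM), toEuclideanLin_one,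
        ← inner_toEuclideanLin_left, real_inner_comm]
      ring
    rw [norm_sub_sq_real, norm_sq_sqrt_apply hM, h1]
    ring
  simp_rw [hpt]
  rw [lintegral_const_mul _ (by fun_prop), lintegral_comp_toEuclideanLin hRdet
      (g := fun z => ENNReal.ofReal (Real.exp (-(1 / 2) * ‖z - a‖ ^ 2))) (by fun_prop),
    lintegral_sub_right_eq_self
      (fun z : Vec n => ENNReal.ofReal (Real.exp (-(1 / 2) * ‖z‖ ^ 2))) a,
    lintegral_gauss (by norm_num), GaussianFourier.integral_rexp_neg_mul_sq_norm (by positivity),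
    ← ENNReal.ofReal_mul (by positivity), ← ENNReal.ofReal_mul (by positivity)]
  congr 1
  have h2 : ‖a‖ ^ 2 / 2 = ‖R⁻¹.toEuclideanLin ((crossSum w y).transpose.toEuclideanLin v)‖ ^ 2 /
      (2 * σ ^ 2) := by
    rw [ha, norm_smul, mul_pow, Real.norm_eq_abs, sq_abs]
    ring
  have h3 : (Real.pi / (1 / 2)) ^ (n / 2 : ℝ) =
      (Real.pi / (lam / 2)) ^ (n / 2 : ℝ) * √(lam ^ n) := by
    have h4 : √(lam ^ n) = lam ^ (n / 2 : ℝ) := by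
      rw [Real.sqrt_eq_rpow, ← Real.rpow_natCast, ← Real.rpow_mul hlam.le]
      congr 1
      ring
    rw [h4, ← Real.mul_rpow (by positivity) hlam.le]
    congr 1
    field_simp
  rw [h2, det_sqrt_eq hM, h3, Real.sqrt_div (by positivity)]
  have h5 : 0 < (Real.pi / (lam / 2)) ^ (n / 2 : ℝ) := by positivity
  simp only [finrank_euclideanSpace, Fintype.card_fin]
  field_simp

/-- The supermartingale mixed over `v`, uniform on the unit ball, and over `θ`, with the law
`N(0, λ⁻¹ I)`. -/
noncomputable def mixture (σ lam : ℝ) (w : ι → Vec m) (y : ι → Vec n) : ℝ≥0∞ :=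
  (volume (Metric.closedBall (0 : Vec m) 1))⁻¹ * ∫⁻ v in Metric.closedBall (0 : Vec m) 1,
    ∫⁻ θ, ∏ i, ENNReal.ofReal (Real.exp (expTerm σ v (w i) θ (y i))) ∂noise n (1 / √lam)

/-- A lower bound on the mixture: the `v` close to the direction of `S R⁻¹ u` fill a ball of radius
`1/4`. -/
lemma le_mixture {σ lam : ℝ} (hlam : 0 < lam) (w : ι → Vec m) (y : ι → Vec n)
    {u : Vec n} (hu : ‖u‖ = 1) :
    ENNReal.ofReal ((1 / 4) ^ m * (√(lam ^ n / (gram lam y).det) * Real.exp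
      (‖(crossSum w y * (CFC.sqrt (gram lam y))⁻¹).toEuclideanLin u‖ ^ 2 / (8 * σ ^ 2)))) ≤
      mixture σ lam w y := by
  set M := crossSum w y * (CFC.sqrt (gram lam y))⁻¹ with hMdef
  set z : Vec m := M.toEuclideanLin u with hz
  -- for `M u = 0` any ball of radius `1/4` in the unit ball will do
  obtain ⟨e, he, hze⟩ : ∃ e : Vec m, ‖e‖ ≤ 1 ∧ z = ‖z‖ • e ∧ (z ≠ 0 → ⟪e, e⟫ = 1) := by
    rcases eq_or_ne z 0 with h | h
    · exact ⟨0, by simp, by simp [h], fun h' => absurd h h'⟩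
    · have hn : ‖‖z‖⁻¹ • z‖ = 1 := by
        rw [norm_smul, norm_inv, norm_norm, inv_mul_cancel₀ (norm_ne_zero_iff.2 h)]
      refine ⟨‖z‖⁻¹ • z, hn.le, ?_, fun _ => ?_⟩
      · rw [smul_smul, mul_inv_cancel₀ (norm_ne_zero_iff.2 h), one_smul]
      · rw [real_inner_self_eq_norm_sq, hn, one_pow]
  set B := Metric.closedBall ((3 / 4 : ℝ) • e) (1 / 4) with hB
  have hsub : B ⊆ Metric.closedBall 0 1 := by
    intro v hv
    rw [hB, mem_closedBall_iff_norm] at hv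
    rw [mem_closedBall_zero_iff]
    have h1 : ‖v‖ ≤ ‖v - (3 / 4 : ℝ) • e‖ + ‖(3 / 4 : ℝ) • e‖ := by
      simpa using norm_add_le (v - (3 / 4 : ℝ) • e) ((3 / 4 : ℝ) • e)
    rw [norm_smul, Real.norm_of_nonneg (by norm_num)] at h1
    linarith
  have hlow : ∀ v ∈ B, ENNReal.ofReal (√(lam ^ n / (gram lam y).det) * Real.exp
      (‖z‖ ^ 2 / (8 * σ ^ 2))) ≤
      ∫⁻ θ, ∏ i, ENNReal.ofReal (Real.exp (expTerm σ v (w i) θ (y i))) ∂noise n (1 / √lam) := by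
    intro v hv
    rw [lintegral_theta_mixture hlam]
    apply ENNReal.ofReal_le_ofReal
    gcongr √_ * Real.exp ?_
    have h1 : ‖z‖ / 2 ≤ ‖(CFC.sqrt (gram lam y))⁻¹.toEuclideanLin
        ((crossSum w y).transpose.toEuclideanLin v)‖ := by
      have h2 : ⟪v, z⟫ ≤ ‖(CFC.sqrt (gram lam y))⁻¹.toEuclideanLin
          ((crossSum w y).transpose.toEuclideanLin v)‖ := by
        have h3 : ⟪v, z⟫ = ⟪(CFC.sqrt (gram lam y))⁻¹.toEuclideanLin
            ((crossSum w y).transpose.toEuclideanLin v), u⟫ := by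
          rw [inner_toEuclideanLin_left, Matrix.transpose_nonsing_inv, transpose_sqrt,
            inner_toEuclideanLin_left, Matrix.transpose_transpose, ← toEuclideanLin_mul, hz]
        rw [h3]
        simpa [hu] using real_inner_le_norm ((CFC.sqrt (gram lam y))⁻¹.toEuclideanLin
            ((crossSum w y).transpose.toEuclideanLin v)) u
      refine le_trans ?_ h2
      rcases eq_or_ne z 0 with h | h
      · simp [h]
      have hee := hze.2 h
      rw [hB, mem_closedBall_iff_norm] at hv
      have h4 : ⟪v, e⟫ = ⟪v - (3 / 4 : ℝ) • e, e⟫ + 3 / 4 := by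
        rw [inner_sub_left, inner_smul_left, hee]
        simp
      have h5 := neg_le_of_abs_le (abs_real_inner_le_norm (v - (3 / 4 : ℝ) • e) e)
      have h6 : ‖v - (3 / 4 : ℝ) • e‖ * ‖e‖ ≤ 1 / 4 := by
        nlinarith [norm_nonneg e, norm_nonneg (v - (3 / 4 : ℝ) • e)]
      have h7 : ⟪v, z⟫ = ‖z‖ * ⟪v, e⟫ := by
        conv_lhs => rw [hze.1, inner_smul_right]
      rw [h7]
      nlinarith [norm_nonneg z]
    have h8 : ‖z‖ ^ 2 / (8 * σ ^ 2) = (‖z‖ / 2) ^ 2 / (2 * σ ^ 2) := by ring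
    rw [h8]
    gcongr
  set c := ENNReal.ofReal (√(lam ^ n / (gram lam y).det) * Real.exp (‖z‖ ^ 2 / (8 * σ ^ 2)))
    with hc
  have hvol : volume B =
      ENNReal.ofReal ((1 / 4) ^ m) * volume (Metric.closedBall (0 : Vec m) 1) := by
    rw [hB, Measure.addHaar_closedBall' _ _ (by norm_num)]
    simp
  have hpos : volume (Metric.closedBall (0 : Vec m) 1) ≠ 0 :=
    (Metric.measure_closedBall_pos _ _ one_pos).ne'
  have hfin : volume (Metric.closedBall (0 : Vec m) 1) ≠ ∞ := measure_closedBall_lt_top.ne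
  calc ENNReal.ofReal ((1 / 4) ^ m * (√(lam ^ n / (gram lam y).det) * Real.exp
        (‖z‖ ^ 2 / (8 * σ ^ 2))))
      = (volume (Metric.closedBall (0 : Vec m) 1))⁻¹ * (c * volume B) := by
        have h1 : ∀ a V : ℝ≥0∞, V⁻¹ * (c * (a * V)) = V * V⁻¹ * (a * c) := fun a V => by ring
        rw [hvol, ENNReal.ofReal_mul (by positivity), ← hc, h1, ENNReal.mul_inv_cancel hpos hfin,
          one_mul]
    _ = (volume (Metric.closedBall (0 : Vec m) 1))⁻¹ * ∫⁻ _ in B, c := by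
        rw [setLIntegral_const]
    _ ≤ (volume (Metric.closedBall (0 : Vec m) 1))⁻¹ * ∫⁻ v in B,
          ∫⁻ θ, ∏ i, ENNReal.ofReal (Real.exp (expTerm σ v (w i) θ (y i)))
            ∂noise n (1 / √lam) := by
        gcongr 1
        exact setLIntegral_mono' measurableSet_closedBall hlow
    _ ≤ mixture σ lam w y := by
        unfold mixture
        gcongr

/-- The self-normalized bound, on the event that the mixture is below the level `q`. -/
lemma selfNormalized_le_of_mixture_lt {σ lam : ℝ} (hσ : 0 < σ) (hlam : 0 < lam) (w : ι → Vec m)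
    (y : ι → Vec n) {q : ℝ} (hq : 0 < q) (hmix : mixture σ lam w y < ENNReal.ofReal q)
    {u : Vec n} (hu : ‖u‖ = 1) :
    ‖(crossSum w y * (CFC.sqrt (gram lam y))⁻¹).toEuclideanLin u‖ ≤
      σ * √(8 * m * Real.log 5 + 8 * Real.log (q * ((gram lam y).det * (lam ^ n)⁻¹))) := by
  have hM := posDef_gram hlam y
  set r := ‖(crossSum w y * (CFC.sqrt (gram lam y))⁻¹).toEuclideanLin u‖ with hr
  have h1 := ((le_mixture (σ := σ) hlam w y hu).trans_lt hmix)
  rw [ENNReal.ofReal_lt_ofReal_iff hq] at h1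
  set D := (gram lam y).det * (lam ^ n)⁻¹ with hD
  have hD1 : 1 ≤ D := by
    rw [hD, ← div_eq_mul_inv, one_le_div (by positivity)]
    exact pow_le_det_gram hlam y
  have hD2 : lam ^ n / (gram lam y).det = D⁻¹ := by
    rw [hD, mul_inv, inv_inv, mul_comm, div_eq_mul_inv]
  have h2 : Real.exp (r ^ 2 / (8 * σ ^ 2)) ≤ 5 ^ m * (q * D) := by
    rw [hD2, Real.sqrt_inv, ← hr] at h1
    have hDs : 0 < √D := Real.sqrt_pos.2 (by linarith)
    -- the claim has `D` in place of `√D`, and `5` in place of `4`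
    have h3 : √D ≤ D := Real.sqrt_le_iff.2 ⟨by linarith, by nlinarith⟩
    have h4 : Real.exp (r ^ 2 / (8 * σ ^ 2)) < 4 ^ m * (q * √D) := by
      have : (1 / 4 : ℝ) ^ m * ((√D)⁻¹ * Real.exp (r ^ 2 / (8 * σ ^ 2))) =
        Real.exp (r ^ 2 / (8 * σ ^ 2)) / (4 ^ m * √D) := by
        rw [div_pow, one_pow]; field_simp
      rw [this, div_lt_iff₀ (by positivity)] at h1
      linarith
    refine h4.le.trans ?_
    gcongr
    norm_num
  have h5 : r ^ 2 / (8 * σ ^ 2) ≤ m * Real.log 5 + Real.log (q * D) := by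
    have h6 := Real.log_le_log (Real.exp_pos _) h2
    rwa [Real.log_exp, Real.log_mul (by positivity) (by positivity), Real.log_pow] at h6
  rw [div_le_iff₀ (by positivity)] at h5
  have h7 : r ^ 2 ≤ σ ^ 2 * (8 * m * Real.log 5 + 8 * Real.log (q * D)) := by linarith
  calc r = √(r ^ 2) := (Real.sqrt_sq (norm_nonneg _)).symm
    _ ≤ √(σ ^ 2 * (8 * m * Real.log 5 + 8 * Real.log (q * D))) := Real.sqrt_le_sqrt h7
    _ = _ := by rw [Real.sqrt_mul (sq_nonneg σ), Real.sqrt_sq hσ.le]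

end Mixture

/-! ### The confidence sets -/

section Confidence

variable {dx dφ : ℕ} {U : Type} {H t : ℕ}

/-- The features of all steps of the episodes `d`. -/
abbrev pastFeature (φ : Vec dx → U → Vec dφ) (d : Fin t → Hist dx U H) :
    Fin t × Fin H → Vec dφ :=
  fun p => φ ((d p.1).1 p.2).1 ((d p.1).1 p.2).2

/-- The noise in all steps of the episodes `d`, if they were played on the system with
parameter `A`. -/
noncomputable abbrev pastResidual (A : Matrix (Fin dx) (Fin dφ) ℝ) (φ : Vec dx → U → Vec dφ)
    (d : Fin t → Hist dx U H) : Fin t × Fin H → Vec dx :=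
  fun p => residual A φ (d p.1) p.2

lemma covariates_eq_gram (φ : Vec dx → U → Vec dφ) (lam : ℝ) (d : Fin t → Hist dx U H) :
    covariates φ lam d = gram lam (pastFeature φ d) := by
  rw [covariates, gram, Fintype.sum_prod_type]

lemma posDef_covariates (φ : Vec dx → U → Vec dφ) {lam : ℝ} (hlam : 0 < lam)
    (d : Fin t → Hist dx U H) : (covariates φ lam d).PosDef := by
  rw [covariates_eq_gram]
  exact posDef_gram hlam _

lemma isMinOn_ridgeLoss_iff (φ : Vec dx → U → Vec dφ) {lam : ℝ} (hlam : 0 < lam)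
    (d : Fin t → Hist dx U H) (B : Matrix (Fin dx) (Fin dφ) ℝ) :
    IsMinOn (ridgeLoss φ lam d) Set.univ B ↔ B * gram lam (pastFeature φ d) =
      ∑ p : Fin t × Fin H, Matrix.vecMulVec (nextState (d p.1) p.2).ofLp
        (pastFeature φ d p).ofLp := by
  rw [← isMinOn_ridge_iff (fun p : Fin t × Fin H => nextState (d p.1) p.2) _ hlam]
  have h : ridgeLoss φ lam d = fun A : Matrix (Fin dx) (Fin dφ) ℝ =>
      (∑ p : Fin t × Fin H, ‖nextState (d p.1) p.2 -
        A.toEuclideanLin (pastFeature φ d p)‖ ^ 2) + lam * ∑ j, ∑ k, A j k ^ 2 := by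
    funext A
    rw [ridgeLoss, Fintype.sum_prod_type]
  rw [h]

lemma radius_eq (φ : Vec dx → U → Vec dφ) (T : ℕ) (σ BA δ lam : ℝ) (d : Fin t → Hist dx U H) :
    radius φ T σ BA δ lam d = √lam * BA + σ * √(8 * dx * Real.log 5 + 8 * Real.log
      (T / δ * ((gram lam (pastFeature φ d)).det * (lam ^ dφ)⁻¹))) := by
  rw [radius, det_smul_one, covariates_eq_gram]
  congr 5
  ring_nf

/-- On the event that the mixture is below `T / δ`, the confidence set contains the parameter of
the system. -/
lemma mem_confSet_of_mixture_lt (φ : Vec dx → U → Vec dφ) {T : ℕ} {σ BA δ lam : ℝ} (hσ : 0 < σ)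
    (hlam : 0 < lam) (hq : 0 < T / δ) {A : Matrix (Fin dx) (Fin dφ) ℝ} (hA : ‖A‖ ≤ BA)
    {d : Fin t → Hist dx U H}
    (hmix : mixture σ lam (pastResidual A φ d) (pastFeature φ d) < ENNReal.ofReal (T / δ)) :
    A ∈ confSet φ T σ BA δ lam d := by
  have hM := posDef_gram hlam (pastFeature φ d)
  set B := (∑ p : Fin t × Fin H, Matrix.vecMulVec (nextState (d p.1) p.2).ofLp
        (pastFeature φ d p).ofLp) * (gram lam (pastFeature φ d))⁻¹ with hB
  have h1 : B * gram lam (pastFeature φ d) =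
      ∑ p : Fin t × Fin H, Matrix.vecMulVec (nextState (d p.1) p.2).ofLp
        (pastFeature φ d p).ofLp := by
    rw [hB, Matrix.mul_assoc, Matrix.nonsing_inv_mul _ hM.det_pos.ne'.isUnit, Matrix.mul_one]
  refine ⟨B, (isMinOn_ridgeLoss_iff φ hlam d B).2 h1, ?_⟩
  rw [covariates_eq_gram, radius_eq]
  exact norm_sub_ridge_mul_sqrt_le (x := fun p : Fin t × Fin H => nextState (d p.1) p.2) hlam h1 A
    hA (fun u hu => selfNormalized_le_of_mixture_lt hσ hlam _ _ hq hmix hu) (by positivity)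

lemma norm_sub_mul_sqrt_le_of_mem_confSet {φ : Vec dx → U → Vec dφ} {T : ℕ} {σ BA δ lam : ℝ}
    (hlam : 0 < lam) {d : Fin t → Hist dx U H} {A A' : Matrix (Fin dx) (Fin dφ) ℝ}
    (hA : A ∈ confSet φ T σ BA δ lam d) (hA' : A' ∈ confSet φ T σ BA δ lam d) :
    ‖(A' - A) * CFC.sqrt (covariates φ lam d)‖ ≤ 2 * radius φ T σ BA δ lam d := by
  obtain ⟨B, hB, h⟩ := hA
  obtain ⟨B', hB', h'⟩ := hA'
  have hM := posDef_gram hlam (pastFeature φ d)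
  rw [isMinOn_ridgeLoss_iff φ hlam] at hB hB'
  have hBB : B' = B := by
    have h1 := congrArg (· * (gram lam (pastFeature φ d))⁻¹) (hB'.trans hB.symm)
    simpa only [Matrix.mul_assoc, Matrix.mul_nonsing_inv _ hM.det_pos.ne'.isUnit,
      Matrix.mul_one] using h1
  rw [hBB] at h'
  have h2 : (A' - A) * CFC.sqrt (covariates φ lam d) =
      (A' - B) * CFC.sqrt (covariates φ lam d) - (A - B) * CFC.sqrt (covariates φ lam d) := by
    rw [← Matrix.sub_mul]
    congr 1
    abel
  rw [h2]
  refine (norm_sub_le _ _).trans ?_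
  linarith

lemma stepDist_le_of_mem_confSet {φ : Vec dx → U → Vec dφ} {T : ℕ} {σ BA δ lam : ℝ} (hσ : 0 < σ)
    (hlam : 0 < lam) {d : Fin t → Hist dx U H} {A A' : Matrix (Fin dx) (Fin dφ) ℝ}
    (hA : A ∈ confSet φ T σ BA δ lam d) (hA' : A' ∈ confSet φ T σ BA δ lam d) {B : ℝ}
    (hB : 6 * radius φ T σ BA δ lam d / σ ≤ B) (x : Vec dx) (u : U) :
    stepDist σ φ (A' - A) x u ≤
      ENNReal.ofReal (min 1 (B * invNorm (covariates φ lam d) (φ x u))) := by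
  unfold stepDist
  apply ENNReal.ofReal_le_ofReal
  apply min_le_min le_rfl
  have h1 := norm_apply_le_invNorm (posDef_covariates φ hlam d) (A' - A) (φ x u)
  have h2 := norm_sub_mul_sqrt_le_of_mem_confSet hlam hA hA'
  have h3 := invNorm_nonneg (covariates φ lam d) (φ x u)
  calc 3 * ‖(A' - A).toEuclideanLin (φ x u)‖ / σ
      ≤ 3 * (2 * radius φ T σ BA δ lam d * invNorm (covariates φ lam d) (φ x u)) / σ := by
        gcongr
        exact h1.trans (mul_le_mul_of_nonneg_right h2 h3)
    _ = 6 * radius φ T σ BA δ lam d / σ * invNorm (covariates φ lam d) (φ x u) := by ring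
    _ ≤ _ := mul_le_mul_of_nonneg_right hB h3

lemma sum_norm_sq_pastFeature_le {φ : Vec dx → U → Vec dφ} {b : ℝ} (hφ : ∀ x u, ‖φ x u‖ ≤ b)
    {T : ℕ} (htT : t ≤ T) (d : Fin t → Hist dx U H) :
    ∑ p, ‖pastFeature φ d p‖ ^ 2 ≤ T * H * b ^ 2 := by
  calc ∑ p, ‖pastFeature φ d p‖ ^ 2 ≤ ∑ _p : Fin t × Fin H, b ^ 2 :=
        Finset.sum_le_sum fun p _ => pow_le_pow_left₀ (norm_nonneg _) (hφ _ _) 2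
    _ = t * H * b ^ 2 := by simp
    _ ≤ T * H * b ^ 2 := by gcongr

lemma log_det_covariates_le {φ : Vec dx → U → Vec dφ} {b lam : ℝ} (hlam : 0 < lam)
    (hφ : ∀ x u, ‖φ x u‖ ≤ b) {T : ℕ} (htT : t ≤ T) (d : Fin t → Hist dx U H) :
    Real.log ((covariates φ lam d).det * (lam ^ dφ)⁻¹) ≤
      dφ * Real.log (1 + T * H * b ^ 2 / lam) := by
  rw [covariates_eq_gram, ← Real.log_pow]
  have h1 := det_gram_le hlam (pastFeature φ d) (sum_norm_sq_pastFeature_le hφ htT d)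
  have h2 := (posDef_gram hlam (pastFeature φ d)).det_pos
  apply Real.log_le_log (by positivity)
  calc _ ≤ (lam + T * H * b ^ 2) ^ dφ * (lam ^ dφ)⁻¹ := by gcongr
    _ = (1 + T * H * b ^ 2 / lam) ^ dφ := by
        rw [← inv_pow, ← mul_pow]
        congr 1
        field_simp

/-- A bound on the confidence radius that does not depend on the trajectories. -/
lemma radius_le {φ : Vec dx → U → Vec dφ} {T : ℕ} {σ BA δ lam b : ℝ} (hσ : 0 < σ) (hT : 1 ≤ T)
    (hδ : 0 < δ) (hlam : 0 < lam) (hφ : ∀ x u, ‖φ x u‖ ≤ b) (htT : t ≤ T)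
    (d : Fin t → Hist dx U H) :
    radius φ T σ BA δ lam d ≤ √lam * BA + σ * √(8 * dx * Real.log 5 + 8 *
      (Real.log T + Real.log (1 / δ) + dφ * Real.log (1 + T * H * b ^ 2 / lam))) := by
  have hT0 : (0 : ℝ) < T := by exact_mod_cast hT
  have h2 := (posDef_covariates φ hlam d).det_pos
  rw [radius_eq, ← covariates_eq_gram, Real.log_mul (by positivity) (by positivity),
    div_eq_mul_one_div, Real.log_mul (by positivity) (by positivity)]
  gcongr
  exact log_det_covariates_le hlam hφ htT d

end Confidence

/-! ### The elliptical potential -/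

section Potential

variable {dx dφ : ℕ} {U : Type} {H : ℕ}

/-- A bound on the loss from playing for an episode with a wrong parameter from the confidence set:
the truncated weighted norms of the features, summed over the trajectory `τ`. -/
noncomputable def potential {t : ℕ} (φ : Vec dx → U → Vec dφ) (lam B : ℝ)
    (d : Fin t → Hist dx U H) (τ : Hist dx U H) : ℝ :=
  ∑ k, min 1 (B * invNorm (covariates φ lam d) (φ (τ.1 k).1 (τ.1 k).2))

lemma potential_nonneg {t : ℕ} (φ : Vec dx → U → Vec dφ) (lam : ℝ) {B : ℝ} (hB : 0 ≤ B)
    (d : Fin t → Hist dx U H) (τ : Hist dx U H) : 0 ≤ potential φ lam B d τ :=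
  Finset.sum_nonneg fun _ _ => le_min zero_le_one (mul_nonneg hB (invNorm_nonneg _ _))

lemma potential_le {t : ℕ} (φ : Vec dx → U → Vec dφ) (lam B : ℝ)
    (d : Fin t → Hist dx U H) (τ : Hist dx U H) : potential φ lam B d τ ≤ H := by
  calc potential φ lam B d τ ≤ ∑ _k : Fin H, (1 : ℝ) :=
        Finset.sum_le_sum fun _ _ => min_le_left _ _
    _ = H := by simp

lemma potential_le_of_norm_le {t : ℕ} {φ : Vec dx → U → Vec dφ} {lam B b : ℝ} (hlam : 0 < lam)
    (hB : 0 ≤ B) (hφ : ∀ x u, ‖φ x u‖ ≤ b) (d : Fin t → Hist dx U H) (τ : Hist dx U H) :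
    potential φ lam B d τ ≤ H * (B * (b / √lam)) := by
  calc potential φ lam B d τ ≤ ∑ _k : Fin H, B * (b / √lam) := by
        refine Finset.sum_le_sum fun k _ => (min_le_right _ _).trans ?_
        gcongr
        rw [covariates_eq_gram]
        refine (invNorm_gram_le hlam _ _).trans ?_
        gcongr
        exact hφ _ _
    _ = H * (B * (b / √lam)) := by simp

lemma covariates_succ {T : ℕ} (φ : Vec dx → U → Vec dφ) (lam : ℝ)
    (d : Fin (T + 1) → Hist dx U H) :
    covariates φ lam d = covariates φ lam (past (Nat.le_succ T) d) +
      ∑ k, Matrix.vecMulVec (φ ((d (Fin.last T)).1 k).1 ((d (Fin.last T)).1 k).2).ofLp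
        (φ ((d (Fin.last T)).1 k).1 ((d (Fin.last T)).1 k).2).ofLp := by
  rw [covariates, covariates, Fin.sum_univ_castSucc, ← add_assoc]
  rfl

lemma sum_log_le_log_det {T : ℕ} (φ : Vec dx → U → Vec dφ) {lam : ℝ} (hlam : 0 < lam)
    (d : Fin T → Hist dx U H) (k : Fin H) :
    ∑ t : Fin T, Real.log (1 + invNorm (covariates φ lam (past t.isLt.le d))
      (φ ((d t).1 k).1 ((d t).1 k).2) ^ 2) ≤
      Real.log ((covariates φ lam d).det * (lam ^ dφ)⁻¹) := by
  induction T with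
  | zero => simp [covariates, hlam.ne']
  | succ T ih =>
    rw [Fin.sum_univ_castSucc]
    have h1 := ih (past (Nat.le_succ T) d)
    have hM := posDef_covariates φ hlam (past (Nat.le_succ T) d)
    have h2 := det_mul_le_det_add_sum hM
      (fun k => φ ((d (Fin.last T)).1 k).1 ((d (Fin.last T)).1 k).2) k
    rw [← covariates_succ] at h2
    set z := invNorm (covariates φ lam (past (Nat.le_succ T) d))
      (φ ((d (Fin.last T)).1 k).1 ((d (Fin.last T)).1 k).2) with hz
    have hdet := hM.det_pos
    calc _ ≤ Real.log ((covariates φ lam (past (Nat.le_succ T) d)).det * (lam ^ dφ)⁻¹) +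
          Real.log (1 + z ^ 2) := add_le_add h1 le_rfl
      _ = Real.log ((covariates φ lam (past (Nat.le_succ T) d)).det * (1 + z ^ 2) *
            (lam ^ dφ)⁻¹) := by
          rw [← Real.log_mul (by positivity) (by positivity)]
          congr 1
          ring
      _ ≤ _ := by
          apply Real.log_le_log (by positivity)
          gcongr

lemma min_one_le_two_mul_log {z : ℝ} (hz : 0 ≤ z) : min 1 z ≤ 2 * Real.log (1 + z) := by
  have h1 := Real.one_sub_inv_le_log_of_pos (by linarith : 0 < 1 + z)
  have h2 : 1 - (1 + z)⁻¹ = z / (1 + z) := by field_simp; ring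
  rw [h2] at h1
  have h3 : min 1 z / 2 ≤ z / (1 + z) := by
    rw [div_le_div_iff₀ (by norm_num) (by linarith)]
    rcases le_total 1 z with h | h
    · rw [min_eq_left h]; linarith
    · rw [min_eq_right h]; nlinarith
  linarith

/-- The elliptical potential lemma. The covariates are updated only at the end of an episode, which
costs a factor `H`. -/
lemma sq_sum_potential_le {T : ℕ} (φ : Vec dx → U → Vec dφ) {lam B : ℝ} (hlam : 0 < lam)
    (hB : 1 ≤ B) (d : Fin T → Hist dx U H) :
    (∑ t : Fin T, potential φ lam B (past t.isLt.le d) (d t)) ^ 2 ≤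
      2 * B ^ 2 * T * H ^ 2 * Real.log ((covariates φ lam d).det * (lam ^ dφ)⁻¹) := by
  set y : Fin T × Fin H → ℝ := fun p => invNorm (covariates φ lam (past p.1.isLt.le d))
    (φ ((d p.1).1 p.2).1 ((d p.1).1 p.2).2) with hy
  have hy0 : ∀ p, 0 ≤ y p := fun p => invNorm_nonneg _ _
  have h1 : ∑ t : Fin T, potential φ lam B (past t.isLt.le d) (d t) ≤ B * ∑ p, min 1 (y p) := by
    simp_rw [potential]
    rw [← Fintype.sum_prod_type' (f := fun (t : Fin T) (k : Fin H) => min 1 (B * invNorm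
      (covariates φ lam (past t.isLt.le d)) (φ ((d t).1 k).1 ((d t).1 k).2))), Finset.mul_sum]
    refine Finset.sum_le_sum fun p _ => ?_
    change min 1 (B * y p) ≤ _
    rw [mul_min_of_nonneg _ _ (by linarith)]
    exact min_le_min (by linarith) le_rfl
  have h0 : 0 ≤ ∑ t : Fin T, potential φ lam B (past t.isLt.le d) (d t) :=
    Finset.sum_nonneg fun t _ => potential_nonneg φ lam (by linarith) _ _
  have h2 : (∑ p, min 1 (y p)) ^ 2 ≤ (T * H : ℝ) * ∑ p, min 1 (y p) ^ 2 := by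
    have := sq_sum_le_card_mul_sum_sq (s := Finset.univ) (f := fun p => min 1 (y p))
    simpa using this
  have h3 : ∑ p, min 1 (y p) ^ 2 ≤
      2 * H * Real.log ((covariates φ lam d).det * (lam ^ dφ)⁻¹) := by
    calc ∑ p, min 1 (y p) ^ 2 ≤ ∑ p, 2 * Real.log (1 + y p ^ 2) := by
          refine Finset.sum_le_sum fun p _ => le_trans ?_ (min_one_le_two_mul_log (sq_nonneg _))
          refine le_min (pow_le_one₀ (le_min zero_le_one (hy0 p)) (min_le_left _ _)) ?_
          exact pow_le_pow_left₀ (le_min zero_le_one (hy0 p)) (min_le_right _ _) 2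
      _ = 2 * ∑ k : Fin H, ∑ t : Fin T, Real.log (1 + y (t, k) ^ 2) := by
          rw [← Finset.mul_sum, Fintype.sum_prod_type, Finset.sum_comm]
      _ ≤ 2 * ∑ _k : Fin H, Real.log ((covariates φ lam d).det * (lam ^ dφ)⁻¹) := by
          gcongr with k
          exact sum_log_le_log_det φ hlam d k
      _ = _ := by simp; ring
  calc _ ≤ (B * ∑ p, min 1 (y p)) ^ 2 := pow_le_pow_left₀ h0 h1 2
    _ = B ^ 2 * (∑ p, min 1 (y p)) ^ 2 := mul_pow _ _ _
    _ ≤ B ^ 2 * ((T * H : ℝ) *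
        (2 * H * Real.log ((covariates φ lam d).det * (lam ^ dφ)⁻¹))) := by
        gcongr
        exact h2.trans (by gcongr)
    _ = _ := by ring

end Potential

/-! ### The exceptional events -/

section Events

variable {dx dφ : ℕ} {U : Type} [MeasurableSpace U] {H : ℕ}

lemma measurable_mixture_integrand (σ : ℝ) (A : Matrix (Fin dx) (Fin dφ) ℝ)
    {φ : Vec dx → U → Vec dφ} (hφ : Measurable (Function.uncurry φ)) (t : ℕ) :
    Measurable fun q : (Fin t → Hist dx U H) × Vec dx × Vec dφ => ∏ p : Fin t × Fin H,
      ENNReal.ofReal (Real.exp (expTerm σ q.2.1 (pastResidual A φ q.1 p) q.2.2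
        (pastFeature φ q.1 p))) := by
  refine Finset.measurable_prod _ fun p _ => ?_
  have h : Measurable fun q : (Fin t → Hist dx U H) × Vec dx × Vec dφ => (q.1 p.1, q.2) := by
    fun_prop
  exact ((measurable_expTerm_residual σ A hφ p.2).comp h).exp.ennreal_ofReal

lemma measurable_lintegral_lintegral {D V Θ : Type*} [MeasurableSpace D] [MeasurableSpace V]
    [MeasurableSpace Θ] (ν : Measure V) [SFinite ν] (ρ : Measure Θ) [SFinite ρ]
    {F : D → V → Θ → ℝ≥0∞} (hF : Measurable fun q : D × V × Θ => F q.1 q.2.1 q.2.2) :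
    Measurable fun d => ∫⁻ v, ∫⁻ θ, F d v θ ∂ρ ∂ν := by
  have h1 : Measurable fun q : (D × V) × Θ => F q.1.1 q.1.2 q.2 :=
    hF.comp (by fun_prop : Measurable fun q : (D × V) × Θ => (q.1.1, q.1.2, q.2))
  exact (h1.lintegral_prod_right' (ν := ρ)).lintegral_prod_right' (ν := ν)

lemma lintegral_lintegral_lintegral_le {D V Θ : Type*} [MeasurableSpace D] [MeasurableSpace V]
    [MeasurableSpace Θ] (μ : Measure D) [SFinite μ] (ν : Measure V) [SFinite ν] (ρ : Measure Θ)
    [IsProbabilityMeasure ρ] {s : Set V} (hs : MeasurableSet s)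
    {F : D → V → Θ → ℝ≥0∞} (hF : Measurable fun q : D × V × Θ => F q.1 q.2.1 q.2.2)
    (h : ∀ v ∈ s, ∀ θ, ∫⁻ d, F d v θ ∂μ ≤ 1) :
    ∫⁻ d, ∫⁻ v in s, ∫⁻ θ, F d v θ ∂ρ ∂ν ∂μ ≤ ν s := by
  have h1 : Measurable fun q : (D × V) × Θ => F q.1.1 q.1.2 q.2 :=
    hF.comp (by fun_prop : Measurable fun q : (D × V) × Θ => (q.1.1, q.1.2, q.2))
  rw [lintegral_lintegral_swap (h1.lintegral_prod_right' (ν := ρ)).aemeasurable, ← setLIntegral_one]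
  refine setLIntegral_mono' hs fun v hv => ?_
  have h2 : Measurable fun q : D × Θ => F q.1 v q.2 :=
    hF.comp (by fun_prop : Measurable fun q : D × Θ => (q.1, v, q.2))
  rw [lintegral_lintegral_swap h2.aemeasurable]
  calc _ ≤ ∫⁻ _θ, 1 ∂ρ := lintegral_mono fun θ => h v hv θ
    _ = 1 := by simp

lemma measurable_mixture (σ lam : ℝ) (A : Matrix (Fin dx) (Fin dφ) ℝ)
    {φ : Vec dx → U → Vec dφ} (hφ : Measurable (Function.uncurry φ)) (t : ℕ) :
    Measurable fun d : Fin t → Hist dx U H =>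
      mixture σ lam (pastResidual A φ d) (pastFeature φ d) :=
  (measurable_lintegral_lintegral _ _ (measurable_mixture_integrand σ A hφ t)).const_mul _

lemma lintegral_mixture_le {σ : ℝ} (hσ : 0 < σ) (lam : ℝ) (x₁ : Vec dx) {φ : Vec dx → U → Vec dφ}
    (hφ : Measurable (Function.uncurry φ)) (A : Matrix (Fin dx) (Fin dφ) ℝ)
    {L : Learner dx U H} (hL : L.IsMeasurable) (t : ℕ) :
    ∫⁻ d, mixture σ lam (pastResidual A φ d) (pastFeature φ d) ∂runLaw σ x₁ φ A L t ≤ 1 := by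
  have hP := isProbabilityMeasure_runLaw σ x₁ hφ A hL t
  have hm := measurable_mixture_integrand (H := H) σ A hφ t
  have hpos : volume (Metric.closedBall (0 : Vec dx) 1) ≠ 0 :=
    (Metric.measure_closedBall_pos _ _ one_pos).ne'
  have hfin : volume (Metric.closedBall (0 : Vec dx) 1) ≠ ∞ := measure_closedBall_lt_top.ne
  unfold mixture
  rw [lintegral_const_mul _ (measurable_lintegral_lintegral _ _ hm),
    ← ENNReal.inv_mul_cancel hpos hfin]
  gcongr 1
  refine lintegral_lintegral_lintegral_le _ _ _ measurableSet_closedBall hm fun v hv θ => ?_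
  simp_rw [Fintype.prod_prod_type]
  exact lintegral_runLaw_exp_le hσ x₁ hφ A hL (mem_closedBall_zero_iff.1 hv) θ t

/-- Markov's inequality for the mixture of the first `t` of `T` episodes. -/
lemma measure_le_mixture_le {σ : ℝ} (hσ : 0 < σ) (lam : ℝ) (x₁ : Vec dx) {φ : Vec dx → U → Vec dφ}
    (hφ : Measurable (Function.uncurry φ)) (A : Matrix (Fin dx) (Fin dφ) ℝ)
    {L : Learner dx U H} (hL : L.IsMeasurable) {T t : ℕ} (htT : t ≤ T) {q : ℝ} (hq : 0 < q) :
    runLaw σ x₁ φ A L T {d | ENNReal.ofReal q ≤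
      mixture σ lam (pastResidual A φ (past htT d)) (pastFeature φ (past htT d))} ≤
      ENNReal.ofReal q⁻¹ := by
  have hm := measurable_mixture (H := H) σ lam A hφ t
  refine (meas_ge_le_lintegral_div (hm.comp (measurable_past htT)).aemeasurable
    (by simpa using hq) ENNReal.ofReal_ne_top).trans ?_
  have h1 := lintegral_runLaw_past σ x₁ hφ A hL htT hm
  simp only [Function.comp_def]
  rw [h1, ENNReal.ofReal_inv_of_pos hq, ← one_div]
  gcongr
  exact lintegral_mixture_le hσ lam x₁ hφ A hL t

/-- Without past episodes the mixture has no fluctuations. -/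
lemma mixture_of_isEmpty {m n : ℕ} {ι : Type*} [Fintype ι] [IsEmpty ι] (σ lam : ℝ)
    (w : ι → Vec m) (y : ι → Vec n) : mixture σ lam w y = 1 := by
  have hpos : volume (Metric.closedBall (0 : Vec m) 1) ≠ 0 :=
    (Metric.measure_closedBall_pos _ _ one_pos).ne'
  have hfin : volume (Metric.closedBall (0 : Vec m) 1) ≠ ∞ := measure_closedBall_lt_top.ne
  simp [mixture, ENNReal.inv_mul_cancel hpos hfin]

/-- The expectation of a function of the next episode, given the past episodes. -/
noncomputable def condExpect (σ : ℝ) (x₁ : Vec dx) (φ : Vec dx → U → Vec dφ)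
    (A : Matrix (Fin dx) (Fin dφ) ℝ) (L : Learner dx U H) {t : ℕ}
    (f : (Fin t → Hist dx U H) × Hist dx U H → ℝ) (d : Fin t → Hist dx U H) : ℝ :=
  (∫⁻ τ, ENNReal.ofReal (f (d, τ)) ∂trajLaw σ x₁ φ A (L t d) H).toReal

lemma lintegral_ofReal_ne_top {Ω : Type*} [MeasurableSpace Ω] {μ : Measure Ω}
    [IsProbabilityMeasure μ] {f : Ω → ℝ} {c : ℝ} (hc : ∀ ω, f ω ≤ c) :
    ∫⁻ ω, ENNReal.ofReal (f ω) ∂μ ≠ ∞ := by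
  refine ((lintegral_mono fun ω => ENNReal.ofReal_le_ofReal (hc ω)).trans_lt ?_).ne
  simp

/-- A bound on the exponential moment by the mean, from `exp (-z) ≤ 1 / (1 + z) ≤ 1 - z / 2` on
`[0, 1]`. -/
lemma lintegral_exp_neg_le {Ω : Type*} [MeasurableSpace Ω] {μ : Measure Ω}
    [IsProbabilityMeasure μ] {f : Ω → ℝ} (hf : Measurable f) (h0 : ∀ ω, 0 ≤ f ω)
    (h1 : ∀ ω, f ω ≤ 1) :
    ∫⁻ ω, ENNReal.ofReal (Real.exp (-f ω)) ∂μ ≤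
      ENNReal.ofReal (Real.exp (-((∫⁻ ω, ENNReal.ofReal (f ω) ∂μ).toReal / 2))) := by
  set E := (∫⁻ ω, ENNReal.ofReal (f ω) ∂μ).toReal with hE
  have hEt : ENNReal.ofReal E = ∫⁻ ω, ENNReal.ofReal (f ω) ∂μ :=
    ENNReal.ofReal_toReal (lintegral_ofReal_ne_top h1)
  have hE0 : 0 ≤ E := ENNReal.toReal_nonneg
  have hpt : ∀ ω, ENNReal.ofReal (Real.exp (-f ω)) +
      ENNReal.ofReal (1 / 2) * ENNReal.ofReal (f ω) ≤ 1 := by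
    intro ω
    rw [← ENNReal.ofReal_mul (by norm_num), ← ENNReal.ofReal_add (Real.exp_pos _).le
      (mul_nonneg (by norm_num) (h0 ω)), ← ENNReal.ofReal_one]
    apply ENNReal.ofReal_le_ofReal
    have h2 := Real.add_one_le_exp (f ω)
    have h3 : Real.exp (-f ω) ≤ 1 / (1 + f ω) := by
      rw [Real.exp_neg, inv_eq_one_div]
      exact one_div_le_one_div_of_le (by linarith [h0 ω]) (by linarith)
    have h4 : 1 / (1 + f ω) ≤ 1 - 1 / 2 * f ω := by
      rw [div_le_iff₀ (by linarith [h0 ω])]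
      nlinarith [h0 ω, h1 ω]
    linarith
  have hsum : ∫⁻ ω, ENNReal.ofReal (Real.exp (-f ω)) ∂μ + ENNReal.ofReal (E / 2) ≤ 1 := by
    have h5 : ENNReal.ofReal (E / 2) = ∫⁻ ω, ENNReal.ofReal (1 / 2) * ENNReal.ofReal (f ω) ∂μ := by
      rw [lintegral_const_mul _ (by fun_prop), ← hEt, ← ENNReal.ofReal_mul (by norm_num)]
      congr 1
      ring
    rw [h5, ← lintegral_add_left (by fun_prop)]
    calc _ ≤ ∫⁻ _, 1 ∂μ := lintegral_mono hpt
      _ = 1 := by simp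
  have h6 : ∫⁻ ω, ENNReal.ofReal (Real.exp (-f ω)) ∂μ ≤ 1 - ENNReal.ofReal (E / 2) :=
    ENNReal.le_sub_of_add_le_right ENNReal.ofReal_ne_top hsum
  refine h6.trans ?_
  rw [← ENNReal.ofReal_one, ← ENNReal.ofReal_sub _ (by positivity)]
  apply ENNReal.ofReal_le_ofReal
  linarith [Real.add_one_le_exp (-(E / 2))]

lemma measurable_condExpect (σ : ℝ) (x₁ : Vec dx) {φ : Vec dx → U → Vec dφ}
    (hφ : Measurable (Function.uncurry φ)) (A : Matrix (Fin dx) (Fin dφ) ℝ)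
    {L : Learner dx U H} (hL : L.IsMeasurable) {t : ℕ}
    {f : (Fin t → Hist dx U H) × Hist dx U H → ℝ} (hf : Measurable f) :
    Measurable (condExpect σ x₁ φ A L f) :=
  (measurable_lintegral_trajLaw σ x₁ hφ A hL t hf.ennreal_ofReal).ennreal_toReal

/-- The sum of bounded nonnegative terms controls the sum of their conditional expectations:
`exp (∑ₜ (E[fₜ | past] / 2 - fₜ))` is a supermartingale. -/
lemma lintegral_exp_condExpect_le (σ : ℝ) (x₁ : Vec dx) {φ : Vec dx → U → Vec dφ}
    (hφ : Measurable (Function.uncurry φ)) (A : Matrix (Fin dx) (Fin dφ) ℝ)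
    {L : Learner dx U H} (hL : L.IsMeasurable)
    {f : (t : ℕ) → (Fin t → Hist dx U H) × Hist dx U H → ℝ} (hf : ∀ t, Measurable (f t))
    (h0 : ∀ t q, 0 ≤ f t q) (h1 : ∀ t q, f t q ≤ 1) (T : ℕ) :
    ∫⁻ d, ENNReal.ofReal (Real.exp (∑ t : Fin T,
      (condExpect σ x₁ φ A L (f t) (past t.isLt.le d) / 2 - f t (past t.isLt.le d, d t))))
        ∂runLaw σ x₁ φ A L T ≤ 1 := by
  have hm : ∀ T, Measurable fun d : Fin T → Hist dx U H =>
      ENNReal.ofReal (Real.exp (∑ t : Fin T,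
        (condExpect σ x₁ φ A L (f t) (past t.isLt.le d) / 2 - f t (past t.isLt.le d, d t)))) := by
    intro T
    refine (Finset.measurable_sum _ fun t _ => ?_).exp.ennreal_ofReal
    exact (((measurable_condExpect σ x₁ hφ A hL (hf t)).comp
      (measurable_past t.isLt.le)).div_const 2).sub
        ((hf t).comp ((measurable_past t.isLt.le).prodMk (measurable_pi_apply t)))
  induction T with
  | zero => simp [runLaw]
  | succ T ih =>
    rw [lintegral_runLaw_succ σ x₁ hφ A hL T (hm (T + 1))]
    refine (lintegral_mono fun d => ?_).trans ih
    have hP := isProbabilityMeasure_trajLaw σ x₁ hφ A (L T d) H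
    have hsnoc : ∀ τ, ∑ t : Fin (T + 1),
        (condExpect σ x₁ φ A L (f t)
          (past t.isLt.le (Fin.snoc (α := fun _ => Hist dx U H) d τ)) / 2 -
          f t (past t.isLt.le (Fin.snoc (α := fun _ => Hist dx U H) d τ),
            Fin.snoc (α := fun _ => Hist dx U H) d τ t)) =
        (∑ t : Fin T, (condExpect σ x₁ φ A L (f t) (past t.isLt.le d) / 2 -
          f t (past t.isLt.le d, d t))) + condExpect σ x₁ φ A L (f T) d / 2 + -f T (d, τ) := by
      intro τ
      rw [Fin.sum_univ_castSucc, add_assoc, ← sub_eq_add_neg]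
      congr 1
      · refine Finset.sum_congr rfl fun t _ => ?_
        have h2 := past_snoc t.isLt.le d τ
        rw [Fin.snoc_castSucc]
        simp only [Fin.val_castSucc, h2]
      · have h2 := past_self_snoc d τ
        rw [Fin.snoc_last]
        simp only [Fin.val_last, h2]
    simp_rw [hsnoc, Real.exp_add _ (-_), ENNReal.ofReal_mul (Real.exp_pos _).le]
    have hfm : Measurable fun τ => f T (d, τ) := (hf T).comp measurable_prodMk_left
    rw [lintegral_const_mul _ (by fun_prop)]
    refine (mul_le_mul_right
      (lintegral_exp_neg_le hfm (fun τ => h0 T _) fun τ => h1 T _) _).trans ?_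
    rw [← ENNReal.ofReal_mul (Real.exp_pos _).le, ← Real.exp_add]
    apply ENNReal.ofReal_le_ofReal
    apply Real.exp_le_exp.2
    unfold condExpect
    linarith

lemma measure_log_le_sum_condExpect_le (σ : ℝ) (x₁ : Vec dx) {φ : Vec dx → U → Vec dφ}
    (hφ : Measurable (Function.uncurry φ)) (A : Matrix (Fin dx) (Fin dφ) ℝ)
    {L : Learner dx U H} (hL : L.IsMeasurable)
    {f : (t : ℕ) → (Fin t → Hist dx U H) × Hist dx U H → ℝ} (hf : ∀ t, Measurable (f t))
    (h0 : ∀ t q, 0 ≤ f t q) (h1 : ∀ t q, f t q ≤ 1) (T : ℕ) {q : ℝ} (hq : 0 < q) :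
    runLaw σ x₁ φ A L T {d | Real.log q ≤ ∑ t : Fin T,
      (condExpect σ x₁ φ A L (f t) (past t.isLt.le d) / 2 - f t (past t.isLt.le d, d t))} ≤
      ENNReal.ofReal q⁻¹ := by
  have hm : Measurable fun d : Fin T → Hist dx U H => ENNReal.ofReal (Real.exp (∑ t : Fin T,
        (condExpect σ x₁ φ A L (f t) (past t.isLt.le d) / 2 - f t (past t.isLt.le d, d t)))) := by
    refine (Finset.measurable_sum _ fun t _ => ?_).exp.ennreal_ofReal
    exact (((measurable_condExpect σ x₁ hφ A hL (hf t)).comp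
      (measurable_past t.isLt.le)).div_const 2).sub
        ((hf t).comp ((measurable_past t.isLt.le).prodMk (measurable_pi_apply t)))
  calc _ ≤ runLaw σ x₁ φ A L T {d | ENNReal.ofReal q ≤ ENNReal.ofReal (Real.exp (∑ t : Fin T,
        (condExpect σ x₁ φ A L (f t) (past t.isLt.le d) / 2 -
          f t (past t.isLt.le d, d t))))} := by
        refine measure_mono fun d hd => ?_
        exact ENNReal.ofReal_le_ofReal ((Real.log_le_iff_le_exp hq).1 hd)
    _ ≤ _ := by
        refine (meas_ge_le_lintegral_div hm.aemeasurable (by simpa using hq)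
          ENNReal.ofReal_ne_top).trans ?_
        rw [ENNReal.ofReal_inv_of_pos hq, ← one_div]
        gcongr
        exact lintegral_exp_condExpect_le σ x₁ hφ A hL hf h0 h1 T

lemma measurable_det {Ω : Type*} [MeasurableSpace Ω] {n : ℕ} {M : Ω → Matrix (Fin n) (Fin n) ℝ}
    (hM : ∀ i j, Measurable fun ω => M ω i j) : Measurable fun ω => (M ω).det := by
  simp_rw [Matrix.det_apply]
  fun_prop

lemma measurable_covariates {φ : Vec dx → U → Vec dφ} (hφ : Measurable (Function.uncurry φ))
    (lam : ℝ) (t : ℕ) (i j : Fin dφ) :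
    Measurable fun d : Fin t → Hist dx U H => covariates φ lam d i j := by
  have h : ∀ (s : Fin t) (k : Fin H), Measurable fun d : Fin t → Hist dx U H =>
      φ ((d s).1 k).1 ((d s).1 k).2 := fun s k =>
    (measurable_feature hφ k).comp (measurable_pi_apply s)
  simp only [covariates, Matrix.add_apply, Matrix.sum_apply, Matrix.vecMulVec_apply]
  fun_prop

/-- The weighted norm is measurable because the matrix determinant lemma expresses it through
determinants. -/
lemma measurable_potential {φ : Vec dx → U → Vec dφ} (hφ : Measurable (Function.uncurry φ))
    {lam : ℝ} (hlam : 0 < lam) (B : ℝ) (t : ℕ) :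
    Measurable fun q : (Fin t → Hist dx U H) × Hist dx U H => potential φ lam B q.1 q.2 := by
  have h1 : ∀ (M : Matrix (Fin dφ) (Fin dφ) ℝ), M.PosDef → ∀ z : Vec dφ, invNorm M z =
      √((M + Matrix.vecMulVec z.ofLp z.ofLp).det / M.det - 1) := by
    intro M hM z
    have := hM.det_pos
    rw [det_add_vecMulVec hM, mul_div_cancel_left₀ _ this.ne', add_sub_cancel_left,
      Real.sqrt_sq (invNorm_nonneg _ _)]
  unfold potential
  refine Finset.measurable_sum _ fun k _ => ?_
  simp_rw [h1 _ (posDef_covariates φ hlam _)]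
  have hc : ∀ i j, Measurable fun q : (Fin t → Hist dx U H) × Hist dx U H =>
      covariates φ lam q.1 i j := fun i j =>
    (measurable_covariates (H := H) hφ lam t i j).comp measurable_fst
  have hz : Measurable fun q : (Fin t → Hist dx U H) × Hist dx U H =>
      φ (q.2.1 k).1 (q.2.1 k).2 := (measurable_feature hφ k).comp measurable_snd
  have hd1 : Measurable fun q : (Fin t → Hist dx U H) × Hist dx U H =>
      (covariates φ lam q.1).det := measurable_det hc
  have hd2 : Measurable fun q : (Fin t → Hist dx U H) × Hist dx U H =>
      (covariates φ lam q.1 + Matrix.vecMulVec (φ (q.2.1 k).1 (q.2.1 k).2).ofLp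
        (φ (q.2.1 k).1 (q.2.1 k).2).ofLp).det := by
    refine measurable_det fun i j => ?_
    simp only [Matrix.add_apply, Matrix.vecMulVec_apply]
    exact (hc i j).add (by fun_prop)
  fun_prop

end Events

/-! ### Regret on the good event -/

section Regret

variable {dx dφ : ℕ} {U : Type} [MeasurableSpace U] {H : ℕ}

lemma measurable_totalCost {cost : Fin H → Vec dx → U → ℝ}
    (hc : ∀ h, Measurable (Function.uncurry (cost h))) :
    Measurable fun τ : Hist dx U H => totalCost cost τ.1 := by
  unfold totalCost
  exact Finset.measurable_sum _ fun h _ => (hc h).comp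
    (by fun_prop : Measurable fun τ : Hist dx U H => ((τ.1 h).1, (τ.1 h).2))

lemma expCost_eq_toReal (σ : ℝ) (x₁ : Vec dx) (φ : Vec dx → U → Vec dφ)
    {cost : Fin H → Vec dx → U → ℝ} (hc : ∀ h, Measurable (Function.uncurry (cost h)))
    (hc0 : ∀ h x u, 0 ≤ cost h x u) (π : Policy dx U) (A : Matrix (Fin dx) (Fin dφ) ℝ) :
    expCost σ x₁ φ cost π A =
      (∫⁻ τ, ENNReal.ofReal (totalCost cost τ.1) ∂trajLaw σ x₁ φ A π H).toReal :=
  integral_eq_lintegral_of_nonneg_ae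
    (.of_forall fun _ => Finset.sum_nonneg fun h _ => hc0 h _ _)
    (measurable_totalCost hc).aestronglyMeasurable

lemma expCost_nonneg (σ : ℝ) (x₁ : Vec dx) (φ : Vec dx → U → Vec dφ)
    {cost : Fin H → Vec dx → U → ℝ} (hc0 : ∀ h x u, 0 ≤ cost h x u)
    (π : Policy dx U) (A : Matrix (Fin dx) (Fin dφ) ℝ) : 0 ≤ expCost σ x₁ φ cost π A :=
  integral_nonneg fun _ => Finset.sum_nonneg fun h _ => hc0 h _ _

lemma expCost_le_cmax (σ : ℝ) (x₁ : Vec dx) {φ : Vec dx → U → Vec dφ}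
    (hφ : Measurable (Function.uncurry φ)) {cost : Fin H → Vec dx → U → ℝ}
    (hc : ∀ h, Measurable (Function.uncurry (cost h))) (hc0 : ∀ h x u, 0 ≤ cost h x u)
    {cmax : ℝ} (hcm0 : 0 ≤ cmax) (hcm : ∀ s : Fin H → Vec dx × U, totalCost cost s ≤ cmax)
    (π : Policy dx U) (A : Matrix (Fin dx) (Fin dφ) ℝ) :
    expCost σ x₁ φ cost π A ≤ cmax := by
  have hP := isProbabilityMeasure_trajLaw σ x₁ hφ A π H
  rw [expCost_eq_toReal σ x₁ φ hc hc0]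
  refine ENNReal.toReal_le_of_le_ofReal hcm0 ?_
  calc _ ≤ ∫⁻ _, ENNReal.ofReal cmax ∂trajLaw σ x₁ φ A π H :=
        lintegral_mono fun τ => ENNReal.ofReal_le_ofReal (hcm τ.1)
    _ = _ := by simp

/-- The loss from playing a policy that is planned for another parameter of the confidence set. -/
lemma expCost_le_add_condExpect {σ : ℝ} (hσ : 0 < σ) (x₁ : Vec dx) {φ : Vec dx → U → Vec dφ}
    (hφ : Measurable (Function.uncurry φ)) {cost : Fin H → Vec dx → U → ℝ}
    (hc : ∀ h, Measurable (Function.uncurry (cost h))) (hc0 : ∀ h x u, 0 ≤ cost h x u)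
    {cmax : ℝ} (hcm0 : 0 ≤ cmax) (hcm : ∀ s : Fin H → Vec dx × U, totalCost cost s ≤ cmax)
    {T t : ℕ} {BA δ lam : ℝ} (hlam : 0 < lam) (L : Learner dx U H) {d : Fin t → Hist dx U H}
    {A A' : Matrix (Fin dx) (Fin dφ) ℝ} (hA : A ∈ confSet φ T σ BA δ lam d)
    (hA' : A' ∈ confSet φ T σ BA δ lam d) {B : ℝ} (hB0 : 0 ≤ B)
    (hB : 6 * radius φ T σ BA δ lam d / σ ≤ B) :
    expCost σ x₁ φ cost (L t d) A ≤ expCost σ x₁ φ cost (L t d) A' +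
      cmax * condExpect σ x₁ φ A L (fun q => potential φ lam B q.1 q.2) d := by
  have hP := isProbabilityMeasure_trajLaw σ x₁ hφ A (L t d) H
  have hP' := isProbabilityMeasure_trajLaw σ x₁ hφ A' (L t d) H
  rw [expCost_eq_toReal σ x₁ φ hc hc0, expCost_eq_toReal σ x₁ φ hc hc0]
  have h1 := lintegral_trajLaw_le hσ x₁ hφ A A' (L t d) H (measurable_totalCost hc).ennreal_ofReal
    (fun τ => ENNReal.ofReal_le_ofReal (hcm τ.1))
  have h2 : ∫⁻ τ, ∑ k : Fin H, stepDist σ φ (A' - A) (τ.1 k).1 (τ.1 k).2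
      ∂trajLaw σ x₁ φ A (L t d) H ≤
      ∫⁻ τ, ENNReal.ofReal (potential φ lam B d τ) ∂trajLaw σ x₁ φ A (L t d) H := by
    refine lintegral_mono fun τ => ?_
    rw [potential, ENNReal.ofReal_sum_of_nonneg fun k _ =>
      le_min zero_le_one (mul_nonneg hB0 (invNorm_nonneg _ _))]
    exact Finset.sum_le_sum fun k _ => stepDist_le_of_mem_confSet hσ hlam hA hA' hB _ _
  have hfin1 := lintegral_ofReal_ne_top (μ := trajLaw σ x₁ φ A' (L t d) H) fun τ => hcm τ.1
  have hfin2 := lintegral_ofReal_ne_top (μ := trajLaw σ x₁ φ A (L t d) H)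
    (potential_le φ lam B d)
  have h3 := h1.trans (add_le_add_right (mul_le_mul_right h2 (ENNReal.ofReal cmax)) _)
  have h4 := ENNReal.toReal_mono (ENNReal.add_ne_top.2
    ⟨hfin1, ENNReal.mul_ne_top ENNReal.ofReal_ne_top hfin2⟩) h3
  rwa [ENNReal.toReal_add hfin1 (ENNReal.mul_ne_top ENNReal.ofReal_ne_top hfin2),
    ENNReal.toReal_mul, ENNReal.toReal_ofReal hcm0] at h4

lemma regret_le_cmax_mul {T : ℕ} (σ : ℝ) (x₁ : Vec dx) {φ : Vec dx → U → Vec dφ}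
    (hφ : Measurable (Function.uncurry φ)) {cost : Fin H → Vec dx → U → ℝ}
    (hc : ∀ h, Measurable (Function.uncurry (cost h))) (hc0 : ∀ h x u, 0 ≤ cost h x u)
    {cmax : ℝ} (hcm0 : 0 ≤ cmax) (hcm : ∀ s : Fin H → Vec dx × U, totalCost cost s ≤ cmax)
    (Pol : Set (Policy dx U)) (A : Matrix (Fin dx) (Fin dφ) ℝ) (L : Learner dx U H)
    (d : Fin T → Hist dx U H) : regret σ x₁ φ cost Pol A L d ≤ cmax * T := by
  have h1 : 0 ≤ sInf ((fun π => expCost σ x₁ φ cost π A) '' Pol) := by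
    refine Real.sInf_nonneg ?_
    rintro _ ⟨π, _, rfl⟩
    exact expCost_nonneg σ x₁ φ hc0 π A
  have h2 : ∑ t : Fin T, expCost σ x₁ φ cost (L t (past t.isLt.le d)) A ≤ ∑ _t : Fin T, cmax :=
    Finset.sum_le_sum fun t _ => expCost_le_cmax σ x₁ hφ hc hc0 hcm0 hcm _ _
  have h3 : ∑ _t : Fin T, cmax = cmax * T := by simp [mul_comm]
  have h4 : (0 : ℝ) ≤ T * sInf ((fun π => expCost σ x₁ φ cost π A) '' Pol) := by positivity
  unfold regret
  linarith

/-- Optimism: as long as the confidence sets contain the true parameter, the optimistic values are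
at most the optimal one, so that the regret is at most the loss from planning for a wrong
parameter. -/
lemma regret_le_sum_condExpect {T : ℕ} {σ : ℝ} (hσ : 0 < σ) (x₁ : Vec dx)
    {φ : Vec dx → U → Vec dφ}
    (hφ : Measurable (Function.uncurry φ)) {cost : Fin H → Vec dx → U → ℝ}
    (hc : ∀ h, Measurable (Function.uncurry (cost h))) (hc0 : ∀ h x u, 0 ≤ cost h x u)
    {cmax : ℝ} (hcm0 : 0 ≤ cmax) (hcm : ∀ s : Fin H → Vec dx × U, totalCost cost s ≤ cmax)
    {BA δ lam : ℝ} (hlam : 0 < lam) {Pol : Set (Policy dx U)} {L : Learner dx U H}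
    (hL : IsLC3 σ x₁ φ cost Pol T BA δ lam L) {A : Matrix (Fin dx) (Fin dφ) ℝ}
    {d : Fin T → Hist dx U H}
    (hA : ∀ t : Fin T, A ∈ confSet φ T σ BA δ lam (past t.isLt.le d)) {B : ℝ} (hB0 : 0 ≤ B)
    (hB : ∀ t : Fin T, 6 * radius φ T σ BA δ lam (past t.isLt.le d) / σ ≤ B) :
    regret σ x₁ φ cost Pol A L d ≤ cmax * ∑ t : Fin T,
      condExpect σ x₁ φ A L (fun q => potential φ lam B q.1 q.2) (past t.isLt.le d) := by
  have h1 : ∀ t : Fin T, expCost σ x₁ φ cost (L t (past t.isLt.le d)) A ≤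
      sInf ((fun π => expCost σ x₁ φ cost π A) '' Pol) + cmax *
        condExpect σ x₁ φ A L (fun q => potential φ lam B q.1 q.2) (past t.isLt.le d) := by
    intro t
    obtain ⟨hmem, Ahat, hAhat, hopt⟩ := hL.2 t t.isLt (past t.isLt.le d)
    refine (expCost_le_add_condExpect hσ x₁ hφ hc hc0 hcm0 hcm hlam L (hA t) hAhat hB0
      (hB t)).trans (add_le_add_left ?_ _)
    refine le_csInf ⟨_, _, hmem, rfl⟩ ?_
    rintro _ ⟨π, hπ, rfl⟩
    exact hopt π hπ A (hA t)
  have h2 := Finset.sum_le_sum fun t (_ : t ∈ Finset.univ) => h1 t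
  rw [Finset.sum_add_distrib, ← Finset.mul_sum] at h2
  simp only [Finset.sum_const, Finset.card_univ, Fintype.card_fin, nsmul_eq_mul] at h2
  unfold regret
  linarith

/-- The union of the exceptional events. No event is needed for `t = 0`, where the mixture is
constant; the `T - 1` others and the one of the concentration bound have probability at most `δ / T`
each. -/
lemma measure_exceptional_le {σ : ℝ} (hσ : 0 < σ) (lam : ℝ) (x₁ : Vec dx)
    {φ : Vec dx → U → Vec dφ}
    (hφ : Measurable (Function.uncurry φ)) (A : Matrix (Fin dx) (Fin dφ) ℝ)
    {L : Learner dx U H} (hL : L.IsMeasurable)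
    {f : (t : ℕ) → (Fin t → Hist dx U H) × Hist dx U H → ℝ} (hf : ∀ t, Measurable (f t))
    (h0 : ∀ t q, 0 ≤ f t q) (h1 : ∀ t q, f t q ≤ 1) {T : ℕ} (hT : 1 ≤ T) {δ : ℝ} (hδ : 0 < δ)
    (hδ1 : δ < 1) :
    runLaw σ x₁ φ A L T ((⋃ t : Fin T, {d | ENNReal.ofReal (T / δ) ≤
        mixture σ lam (pastResidual A φ (past t.isLt.le d)) (pastFeature φ (past t.isLt.le d))}) ∪
      {d | Real.log (T / δ) ≤ ∑ t : Fin T, (condExpect σ x₁ φ A L (f t) (past t.isLt.le d) / 2 -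
        f t (past t.isLt.le d, d t))}) ≤ ENNReal.ofReal δ := by
  have hT0 : (0 : ℝ) < T := by exact_mod_cast hT
  have hq : 0 < T / δ := by positivity
  have hq1 : 1 < T / δ := by
    rw [one_lt_div hδ]
    have : (1 : ℝ) ≤ T := by exact_mod_cast hT
    linarith
  refine (measure_union_le _ _).trans ?_
  have h2 := measure_log_le_sum_condExpect_le σ x₁ hφ A hL hf h0 h1 T hq
  have h3 : runLaw σ x₁ φ A L T (⋃ t : Fin T, {d | ENNReal.ofReal (T / δ) ≤
      mixture σ lam (pastResidual A φ (past t.isLt.le d)) (pastFeature φ (past t.isLt.le d))}) ≤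
      ENNReal.ofReal ((T - 1) * (T / δ)⁻¹) := by
    obtain ⟨S, rfl⟩ : ∃ S, T = S + 1 := ⟨T - 1, by omega⟩
    refine (measure_iUnion_fintype_le _ _).trans ?_
    rw [Fin.sum_univ_succ]
    have h4 : {d : Fin (S + 1) → Hist dx U H | ENNReal.ofReal ((S + 1 : ℕ) / δ) ≤
        mixture σ lam (pastResidual A φ (past (0 : Fin (S + 1)).isLt.le d))
          (pastFeature φ (past (0 : Fin (S + 1)).isLt.le d))} = ∅ := by
      rw [Set.eq_empty_iff_forall_notMem]
      intro d hd
      rw [Set.mem_ofPred_eq] at hd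
      have : IsEmpty (Fin ((0 : Fin (S + 1)) : ℕ) × Fin H) := by
        rw [Fin.val_zero]; infer_instance
      rw [mixture_of_isEmpty] at hd
      rw [← ENNReal.ofReal_one, ENNReal.ofReal_le_ofReal_iff zero_le_one] at hd
      exact absurd hd (not_le.2 hq1)
    rw [h4, measure_empty, zero_add]
    calc _ ≤ ∑ _t : Fin S, ENNReal.ofReal ((S + 1 : ℕ) / δ)⁻¹ :=
          Finset.sum_le_sum fun t _ =>
            measure_le_mixture_le hσ lam x₁ hφ A hL t.succ.isLt.le hq
      _ = _ := by
          rw [Finset.sum_const, Finset.card_univ, Fintype.card_fin, nsmul_eq_mul,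
            ENNReal.ofReal_mul (by simp)]
          simp
  refine (add_le_add h3 h2).trans ?_
  have hT1 : (1 : ℝ) ≤ T := by exact_mod_cast hT
  rw [← ENNReal.ofReal_add (mul_nonneg (by linarith) (by positivity)) (by positivity)]
  apply ENNReal.ofReal_le_ofReal
  apply le_of_eq
  field_simp
  ring

lemma ofReal_one_sub_le_measure {Ω : Type*} [MeasurableSpace Ω] {μ : Measure Ω}
    [IsProbabilityMeasure μ] {s t : Set Ω} {δ : ℝ} (hδ : 0 ≤ δ) (hs : μ s ≤ ENNReal.ofReal δ)
    (hst : sᶜ ⊆ t) : ENNReal.ofReal (1 - δ) ≤ μ t := by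
  rw [ENNReal.ofReal_sub _ hδ, ENNReal.ofReal_one, tsub_le_iff_right]
  calc (1 : ℝ≥0∞) = μ Set.univ := measure_univ.symm
    _ ≤ μ (t ∪ s) := measure_mono fun ω _ => by
        by_cases h : ω ∈ s
        · exact Or.inr h
        · exact Or.inl (hst h)
    _ ≤ μ t + μ s := measure_union_le _ _
    _ ≤ _ := by gcongr

lemma condExpect_mul_left (σ : ℝ) (x₁ : Vec dx) (φ : Vec dx → U → Vec dφ)
    (A : Matrix (Fin dx) (Fin dφ) ℝ) (L : Learner dx U H) {t : ℕ}
    {f : (Fin t → Hist dx U H) × Hist dx U H → ℝ} (hf : Measurable f) {c : ℝ} (hc : 0 ≤ c)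
    (d : Fin t → Hist dx U H) :
    condExpect σ x₁ φ A L (fun q => c * f q) d = c * condExpect σ x₁ φ A L f d := by
  have hfm : Measurable fun τ => f (d, τ) := hf.comp measurable_prodMk_left
  unfold condExpect
  simp_rw [ENNReal.ofReal_mul hc]
  rw [lintegral_const_mul _ (by fun_prop), ENNReal.toReal_mul, ENNReal.toReal_ofReal hc]

lemma condExpect_le (σ : ℝ) (x₁ : Vec dx) {φ : Vec dx → U → Vec dφ}
    (hφ : Measurable (Function.uncurry φ)) (A : Matrix (Fin dx) (Fin dφ) ℝ)
    (L : Learner dx U H) {t : ℕ} {f : (Fin t → Hist dx U H) × Hist dx U H → ℝ} {c : ℝ}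
    (hc : 0 ≤ c) (d : Fin t → Hist dx U H) (hf : ∀ τ, f (d, τ) ≤ c) :
    condExpect σ x₁ φ A L f d ≤ c := by
  have hP := isProbabilityMeasure_trajLaw σ x₁ hφ A (L t d) H
  refine ENNReal.toReal_le_of_le_ofReal hc ?_
  calc _ ≤ ∫⁻ _, ENNReal.ofReal c ∂trajLaw σ x₁ φ A (L t d) H :=
        lintegral_mono fun τ => ENNReal.ofReal_le_ofReal (hf τ)
    _ = _ := by simp

/-- The regret bound before optimization: with probability `1 - δ` the regret is at most `cmax`
times each of two numbers. The first uses only `‖φ‖_{Σ⁻¹} ≤ ‖φ‖ / √λ`, the second the elliptical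
potential and concentration. -/
lemma ofReal_le_measure_regret_le {T : ℕ} {σ : ℝ} (hσ : 0 < σ) (x₁ : Vec dx)
    {φ : Vec dx → U → Vec dφ}
    (hφ : Measurable (Function.uncurry φ)) {cost : Fin H → Vec dx → U → ℝ}
    (hc : ∀ h, Measurable (Function.uncurry (cost h))) (hc0 : ∀ h x u, 0 ≤ cost h x u)
    {cmax : ℝ} (hcm0 : 0 ≤ cmax) (hcm : ∀ s : Fin H → Vec dx × U, totalCost cost s ≤ cmax)
    {BA δ lam : ℝ} (hlam : 0 < lam) {Pol : Set (Policy dx U)} {L : Learner dx U H}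
    (hL : IsLC3 σ x₁ φ cost Pol T BA δ lam L) {A : Matrix (Fin dx) (Fin dφ) ℝ} (hA : ‖A‖ ≤ BA)
    (hH : 1 ≤ H) (hT : 1 ≤ T) (hδ : 0 < δ) (hδ1 : δ < 1) {b : ℝ} (hb : 0 ≤ b)
    (hφb : ∀ x u, ‖φ x u‖ ≤ b) {κ B R : ℝ} (hκ : κ = Real.log (1 + T * H * b ^ 2 / lam))
    (hB : B = 1 + 6 * (√lam * BA / σ +
      √(8 * dx * Real.log 5 + 8 * (Real.log T + Real.log (1 / δ) + dφ * κ))))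
    (hR : T * H * (B * (b / √lam)) ≤ R ∨
      2 * (√(2 * B ^ 2 * T * H ^ 2 * (dφ * κ)) + H * Real.log (T / δ)) ≤ R) :
    ENNReal.ofReal (1 - δ) ≤ runLaw σ x₁ φ A L T
      {d | regret σ x₁ φ cost Pol A L d ≤ cmax * R} := by
  have hPr := isProbabilityMeasure_runLaw σ x₁ hφ A hL.1 T
  have hBA : 0 ≤ BA := (norm_nonneg A).trans hA
  have hB1 : 1 ≤ B := by rw [hB, le_add_iff_nonneg_right]; positivity
  have hH0 : (0 : ℝ) < H := by exact_mod_cast hH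
  have hT0 : (0 : ℝ) < T := by exact_mod_cast hT
  have hpot : ∀ t : ℕ, Measurable fun q : (Fin t → Hist dx U H) × Hist dx U H =>
      potential φ lam B q.1 q.2 := fun t => measurable_potential hφ hlam B t
  refine ofReal_one_sub_le_measure hδ.le (measure_exceptional_le hσ lam x₁ hφ A hL.1
    (f := fun t q => (H : ℝ)⁻¹ * potential φ lam B q.1 q.2) (fun t => (hpot t).const_mul _)
    (fun t q => mul_nonneg (by positivity) (potential_nonneg φ lam (by linarith) _ _))
    -- the concentration bound is for terms in `[0, 1]`, hence the factor `1 / H`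
    (fun t q => by
      rw [inv_mul_le_iff₀ hH0, mul_one]
      exact potential_le φ lam B _ _) hT hδ hδ1) ?_
  intro d hd
  rw [Set.mem_compl_iff, Set.mem_union, not_or, Set.mem_iUnion, not_exists] at hd
  obtain ⟨hd1, hd2⟩ := hd
  have hmem : ∀ t : Fin T, A ∈ confSet φ T σ BA δ lam (past t.isLt.le d) := fun t =>
    mem_confSet_of_mixture_lt φ hσ hlam (by positivity) hA (not_le.1 (hd1 t))
  have hrad : ∀ t : Fin T, 6 * radius φ T σ BA δ lam (past t.isLt.le d) / σ ≤ B := by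
    intro t
    have h1 := radius_le (BA := BA) hσ hT hδ hlam hφb t.isLt.le (past t.isLt.le d)
    rw [← hκ] at h1
    calc 6 * radius φ T σ BA δ lam (past t.isLt.le d) / σ ≤ 6 * (√lam * BA + σ *
          √(8 * dx * Real.log 5 + 8 * (Real.log T + Real.log (1 / δ) + dφ * κ))) / σ := by
          gcongr
      _ = B - 1 := by rw [hB]; field_simp; ring
      _ ≤ B := by linarith
  have hreg := regret_le_sum_condExpect hσ x₁ hφ hc hc0 hcm0 hcm hlam hL hmem (by linarith) hrad
  refine hreg.trans (mul_le_mul_of_nonneg_left ?_ hcm0)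
  rcases hR with hR | hR
  · refine le_trans ?_ hR
    have h1 : 0 ≤ H * (B * (b / √lam)) :=
      mul_nonneg hH0.le (mul_nonneg (by linarith) (by positivity))
    calc _ ≤ ∑ _t : Fin T, H * (B * (b / √lam)) := Finset.sum_le_sum fun t _ =>
          condExpect_le σ x₁ hφ A L h1 _ fun τ =>
            potential_le_of_norm_le hlam (by linarith) hφb _ _
      _ = _ := by simp; ring
  · refine le_trans ?_ hR
    rw [Set.mem_ofPred_eq, not_le] at hd2
    simp_rw [condExpect_mul_left σ x₁ φ A L (hpot _) (inv_nonneg.2 hH0.le)] at hd2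
    rw [Finset.sum_sub_distrib, ← Finset.mul_sum, ← Finset.sum_div, ← Finset.mul_sum] at hd2
    have h1 := sq_sum_potential_le φ hlam hB1 d
    have h2 : Real.log ((covariates φ lam d).det * (lam ^ dφ)⁻¹) ≤ dφ * κ := by
      rw [hκ]
      exact log_det_covariates_le hlam hφb le_rfl d
    have h3 : ∑ t : Fin T, potential φ lam B (past t.isLt.le d) (d t) ≤
        √(2 * B ^ 2 * T * H ^ 2 * (dφ * κ)) := by
      apply Real.le_sqrt_of_sq_le
      exact h1.trans (by gcongr)
    set E := ∑ t : Fin T,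
      condExpect σ x₁ φ A L (fun q => potential φ lam B q.1 q.2) (past t.isLt.le d)
    set P := ∑ t : Fin T, potential φ lam B (past t.isLt.le d) (d t)
    have h4 : E < 2 * (P + H * Real.log (T / δ)) := by
      have h5 := mul_lt_mul_of_pos_left hd2 hH0
      have h6 : (H : ℝ) * ((H : ℝ)⁻¹ * E / 2 - (H : ℝ)⁻¹ * P) = E / 2 - P := by field_simp
      rw [h6] at h5
      linarith
    linarith

end Regret

/-! ### Optimizing the bound -/

section Arithmetic

lemma log_le_two_mul_sqrt {T : ℝ} (hT : 0 < T) : Real.log T ≤ 2 * √T := by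
  have h1 := Real.log_le_self (Real.sqrt_nonneg T)
  rw [Real.log_sqrt hT.le] at h1
  linarith

lemma one_half_le_log_one_add {x : ℝ} (hx : 1 ≤ x) : 1 / 2 ≤ Real.log (1 + x) := by
  have h1 := Real.log_two_gt_d9
  have h2 := Real.log_le_log (by norm_num) (by linarith : (2 : ℝ) ≤ 1 + x)
  linarith

lemma half_le_log_one_add {x : ℝ} (hx0 : 0 ≤ x) (hx : x ≤ 1) : x / 2 ≤ Real.log (1 + x) := by
  have h1 := Real.one_sub_inv_le_log_of_pos (by linarith : 0 < 1 + x)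
  have h2 : x / 2 ≤ 1 - (1 + x)⁻¹ := by
    have : 1 - (1 + x)⁻¹ = x / (1 + x) := by field_simp; ring
    rw [this]
    gcongr
    linarith
  linarith

lemma log_one_add_sq_le {x : ℝ} (hx : 1 ≤ x) : Real.log (1 + x ^ 2) ≤ 2 * Real.log (1 + x) := by
  have h1 : 2 * Real.log (1 + x) = Real.log ((1 + x) ^ 2) := by rw [Real.log_pow]; norm_num
  rw [h1]
  apply Real.log_le_log (by positivity)
  nlinarith

/-- A bound on the square of the multiplier `B` of the weighted norms. -/
lemma sq_multiplier_le {dx dφ q p lT l κ B : ℝ} (hdx : 0 ≤ dx) (hdφ : 1 ≤ dφ) (hp : p ^ 2 ≤ q)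
    (hlT : 0 ≤ lT) (hl : 0 ≤ l) (hκ : 0 ≤ κ)
    (hB : B = 1 + 6 * (p + √(8 * dx * Real.log 5 + 8 * (lT + l + dφ * κ)))) :
    B ^ 2 ≤ 1728 * (dφ + dx + q + l + lT + dφ * κ) := by
  have h5 : Real.log 5 ≤ 2 := by
    rw [Real.log_le_iff_le_exp (by norm_num)]
    have h1 : Real.exp 1 ^ 2 = Real.exp 2 := by rw [← Real.exp_nat_mul]; norm_num
    have := Real.exp_one_gt_d9
    nlinarith
  have h50 : 0 ≤ Real.log 5 := Real.log_nonneg (by norm_num)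
  have hs0 : 0 ≤ 8 * dx * Real.log 5 + 8 * (lT + l + dφ * κ) := by positivity
  have hs := Real.sq_sqrt hs0
  set r := √(8 * dx * Real.log 5 + 8 * (lT + l + dφ * κ))
  have h2 : B ^ 2 ≤ 3 * (1 + 36 * p ^ 2 + 36 * r ^ 2) := by
    rw [hB]
    nlinarith [sq_nonneg (1 - 6 * p), sq_nonneg (1 - 6 * r), sq_nonneg (6 * p - 6 * r)]
  have h3 : dx * Real.log 5 ≤ dx * 2 := mul_le_mul_of_nonneg_left h5 hdx
  have h4 : 0 ≤ dφ * κ := by positivity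
  nlinarith [sq_nonneg p]

/-- The bound that uses only `‖φ‖_{Σ⁻¹} ≤ ‖φ‖ / √λ`, for `x` that is small compared with `T`. In the
case distinction the auxiliary number `M` is `T` (if `x ≤ 1`) or `√T`. -/
lemma mul_multiplier_le {dx dφ q l T x m M κ B L D lT : ℝ} (hdx : 0 ≤ dx) (hdφ : 1 ≤ dφ)
    (hq : 0 ≤ q) (hl : 0 ≤ l) (hT : 0 ≤ T) (hm : 1 ≤ m) (hmq : m ≤ 1 + q)
    (hL : 0 ≤ L) (hD : D = dφ + dx + q + l)
    (hB : B ^ 2 ≤ 1728 * (dφ + dx + q + l + lT + dφ * κ)) (hmM : m ≤ M)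
    (hxM : x ^ 2 * M ≤ 4 * T * L ^ 2) (hlT : lT ≤ 2 * M) (hκ : κ ≤ M) :
    B * (x * √m) ≤ 600 * √(dφ * D * T) * L := by
  have hD1 : 1 + q ≤ D := by rw [hD]; linarith
  have hM : 0 ≤ M := by linarith
  have hD0 : 0 ≤ D := by linarith
  have h1 : (dφ + dx + q + l + lT + dφ * κ) * m ≤ 4 * M * dφ * D := by
    have e1 : D * m ≤ M * dφ * D := by
      calc D * m ≤ D * M := by gcongr
        _ ≤ M * dφ * D := by nlinarith [mul_nonneg hD0 hM]
    have e2 : lT * m ≤ 2 * M * dφ * D := by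
      calc lT * m ≤ 2 * M * m := by gcongr
        _ ≤ 2 * M * D := by gcongr; linarith
        _ ≤ 2 * M * dφ * D := by nlinarith [mul_nonneg hD0 hM]
    have e3 : dφ * κ * m ≤ M * dφ * D := by
      calc dφ * κ * m ≤ dφ * M * D := by gcongr; linarith
        _ = M * dφ * D := by ring
    rw [← hD]
    linarith
  refine le_of_sq_le_sq ?_ (by positivity)
  rw [mul_pow, mul_pow, mul_pow, mul_pow, Real.sq_sqrt (by linarith : (0 : ℝ) ≤ m),
    Real.sq_sqrt (by positivity)]
  calc B ^ 2 * (x ^ 2 * m) ≤ 1728 * (dφ + dx + q + l + lT + dφ * κ) * (x ^ 2 * m) := by gcongr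
    _ = 1728 * x ^ 2 * ((dφ + dx + q + l + lT + dφ * κ) * m) := by ring
    _ ≤ 1728 * x ^ 2 * (4 * M * dφ * D) := by gcongr
    _ = 1728 * 4 * (dφ * D) * (x ^ 2 * M) := by ring
    _ ≤ 1728 * 4 * (dφ * D) * (4 * T * L ^ 2) := by gcongr
    _ ≤ 600 ^ 2 * (dφ * D * T) * L ^ 2 := by
        have : 0 ≤ dφ * D * T * L ^ 2 := by positivity
        linarith

/-- The bound from the elliptical potential and concentration, for `x ≥ 1` such that
`log T` is at most of the order of `log (1 + x) + 1 + q`. -/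
lemma potential_bound_le {dx dφ q l T H κ B L D lT : ℝ} (hdx : 0 ≤ dx) (hdφ : 1 ≤ dφ)
    (hq : 0 ≤ q) (hl : 0 ≤ l) (hT : 1 ≤ T) (hH : 1 ≤ H) (hL : 1 / 2 ≤ L)
    (hD : D = dφ + dx + q + l)
    (hB : B ^ 2 ≤ 1728 * (dφ + dx + q + l + lT + dφ * κ)) (hκ0 : 0 ≤ κ) (hκ : κ ≤ 2 * L)
    (hlT : lT ≤ 4 * L + 2 * (1 + q)) (hlT' : lT ≤ 2 * √T) (hlT2 : l ≤ T) :
    2 * (√(2 * B ^ 2 * T * H ^ 2 * (dφ * κ)) + H * (lT + l)) ≤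
      600 * H * √(dφ * D * T) * L := by
  have hD1 : 1 + q ≤ D := by rw [hD]; linarith
  have hDφ : dφ ≤ D := by rw [hD]; linarith
  have hD0 : 0 ≤ D := by linarith
  set S := √(dφ * D * T) with hS
  have hS0 : 0 ≤ S := Real.sqrt_nonneg _
  have hB2 : B ^ 2 ≤ 1728 * (12 * (D * L)) := by
    refine hB.trans ?_
    have e1 : dφ * κ ≤ 2 * (D * L) := by
      calc dφ * κ ≤ D * (2 * L) := by gcongr
        _ = 2 * (D * L) := by ring
    have e2 : D ≤ 2 * (D * L) := by nlinarith
    have e3 : L ≤ D * L := by nlinarith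
    have : dφ + dx + q + l + lT + dφ * κ ≤ 12 * (D * L) := by rw [← hD]; linarith
    linarith
  have h1 : √(2 * B ^ 2 * T * H ^ 2 * (dφ * κ)) ≤ 288 * H * S * L := by
    rw [Real.sqrt_le_left (by positivity), mul_pow, mul_pow, mul_pow, hS,
      Real.sq_sqrt (by positivity)]
    calc 2 * B ^ 2 * T * H ^ 2 * (dφ * κ) ≤
          2 * (1728 * (12 * (D * L))) * T * H ^ 2 * (dφ * (2 * L)) := by gcongr
      _ = 288 ^ 2 * H ^ 2 * (dφ * D * T) * L ^ 2 := by ring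
  have hT0 : √T ≤ S := by
    apply Real.sqrt_le_sqrt
    have : 1 ≤ dφ * D := by nlinarith
    nlinarith
  have hl1 : l ≤ S := by
    apply Real.le_sqrt_of_sq_le
    calc l ^ 2 = l * l := sq l
      _ ≤ D * T := by gcongr; rw [hD]; linarith
      _ ≤ dφ * D * T := by
          have : D ≤ dφ * D := by nlinarith
          gcongr
  have h2 : H * (lT + l) ≤ 6 * H * S * L := by
    have e1 : S ≤ 2 * (S * L) := by nlinarith
    calc H * (lT + l) ≤ H * (6 * (S * L)) := by gcongr; linarith
      _ = _ := by ring
  have h3 : 0 ≤ H * S * L := by positivity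
  linarith

/-- The case distinction. Here `x = b H T / σ`, the regularizer is `λ = σ² / m`, and `q` is the
power of `BA` in the bound. The alternatives are the trivial bound, the one from the size of the
features, and the one from the elliptical potential. -/
lemma regret_bound_cases {dx dφ T H σ BA b δ q m lam κ B : ℝ} (hdx0 : 0 ≤ dx) (hdφ1 : 1 ≤ dφ)
    (hH1 : 1 ≤ H) (hT1 : 1 ≤ T) (hσ : 0 < σ) (hBA : 0 < BA) (hb : 0 ≤ b) (hδ : 0 < δ) (hδ1 : δ < 1)
    (hq : 0 ≤ q) (hm : 1 ≤ m) (hmq : m ≤ 1 + q) (hBAq : BA ^ 2 ≤ m * q)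
    (hcase : m ≤ T ∨ σ ≤ b * H * T) (hlam : lam = σ ^ 2 / m)
    (hκ : κ = Real.log (1 + T * H * b ^ 2 / lam))
    (hB : B = 1 + 6 * (√lam * BA / σ +
      √(8 * dx * Real.log 5 + 8 * (Real.log T + Real.log (1 / δ) + dφ * κ)))) :
    T ≤ 600 * H * √(dφ * (dφ + dx + q + Real.log (1 / δ)) * T) *
        Real.log (1 + b * H * T / σ) ∨
      (T * H * (B * (b / √lam)) ≤ 600 * H * √(dφ * (dφ + dx + q + Real.log (1 / δ)) * T) *
        Real.log (1 + b * H * T / σ) ∨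
      2 * (√(2 * B ^ 2 * T * H ^ 2 * (dφ * κ)) + H * Real.log (T / δ)) ≤
        600 * H * √(dφ * (dφ + dx + q + Real.log (1 / δ)) * T) *
        Real.log (1 + b * H * T / σ)) := by
  have hl : 0 ≤ Real.log (1 / δ) := Real.log_nonneg (by rw [one_le_div hδ]; linarith)
  have hlTδ : Real.log (T / δ) = Real.log T + Real.log (1 / δ) := by
    rw [div_eq_mul_one_div, Real.log_mul (by positivity) (by positivity)]
  have hT0 : 0 < T := by linarith
  have hH0 : 0 < H := by linarith
  have hdφ0 : 0 < dφ := by linarith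
  set l := Real.log (1 / δ)
  set D : ℝ := dφ + dx + q + l with hD
  set x := b * H * T / σ with hx
  set L := Real.log (1 + x) with hL
  set S := √(dφ * D * T) with hS
  have hx0 : 0 ≤ x := by positivity
  have hL0 : 0 ≤ L := Real.log_nonneg (by linarith)
  have hm0 : 0 < m := by linarith
  have hlam0 : 0 < lam := by rw [hlam]; positivity
  have hsm : 0 < √m := Real.sqrt_pos.2 hm0
  have hslam : √lam = σ / √m := by
    rw [hlam, Real.sqrt_div (sq_nonneg σ), Real.sqrt_sq hσ.le]
  have hlT0 : 0 ≤ Real.log T := Real.log_nonneg hT1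
  have hκ0 : 0 ≤ κ := by
    rw [hκ]
    exact Real.log_nonneg (by rw [le_add_iff_nonneg_right]; positivity)
  have hp : (√lam * BA / σ) ^ 2 ≤ q := by
    have : (√lam * BA / σ) ^ 2 = BA ^ 2 / m := by
      rw [div_pow, mul_pow, Real.sq_sqrt hlam0.le, hlam]
      field_simp
    rw [this, div_le_iff₀ hm0]
    linarith
  have hB2 := sq_multiplier_le hdx0 hdφ1 hp hlT0 hl hκ0 hB
  have hB0 : 0 ≤ B := by rw [hB]; positivity
  have hlhs : T * H * (B * (b / √lam)) = B * (x * √m) := by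
    rw [hslam, hx]
    field_simp
  have hlTs := log_le_two_mul_sqrt (by linarith : (0 : ℝ) < T)
  -- a bound by `T` suffices as soon as `D` is at least `T`
  have htriv : 1 ≤ x → T ≤ D → T ≤ 600 * H * S * L := by
    intro hx1 hTD
    have h1 := one_half_le_log_one_add hx1
    have h2 : T ≤ S := by
      apply Real.le_sqrt_of_sq_le
      rw [sq]
      have : T ≤ dφ * D := by
        calc T = 1 * T := (one_mul T).symm
          _ ≤ dφ * D := by gcongr
      gcongr
    have h3 : S ≤ S * (600 * (H * L)) := by
      apply le_mul_of_one_le_right (Real.sqrt_nonneg _)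
      have : 1 * (1 / 2) ≤ H * L := mul_le_mul hH1 h1 (by norm_num) (by linarith)
      linarith
    linarith
  -- the deterministic bound
  have hdet : ∀ M : ℝ, m ≤ M → x ^ 2 * M ≤ 4 * T * L ^ 2 → Real.log T ≤ 2 * M → κ ≤ M →
      T * H * (B * (b / √lam)) ≤ 600 * H * S * L := by
    intro M h1 h2 h3 h4
    have h5 := mul_multiplier_le hdx0 hdφ1 hq hl (by linarith : (0 : ℝ) ≤ T) hm hmq hL0 hD
      hB2 h1 h2 h3 h4
    rw [hlhs]
    calc B * (x * √m) ≤ 1 * (600 * S * L) := by rw [one_mul]; exact h5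
      _ ≤ H * (600 * S * L) := by gcongr
      _ = 600 * H * S * L := by ring
  by_cases hmT : m ≤ T
  swap
  · left
    have hx1 : 1 ≤ x := by
      rw [hx, one_le_div hσ]
      exact hcase.resolve_left hmT
    refine htriv hx1 ?_
    push Not at hmT
    linarith
  have hκx : κ ≤ Real.log (1 + x ^ 2) := by
    rw [hκ]
    apply Real.log_le_log (by positivity)
    gcongr
    have h1 : T * H * b ^ 2 / lam = x ^ 2 * (m / (H * T)) := by
      rw [hlam, hx]
      field_simp
    rw [h1]
    apply mul_le_of_le_one_right (sq_nonneg x)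
    rw [div_le_one (by positivity)]
    calc m ≤ T := hmT
      _ = 1 * T := (one_mul T).symm
      _ ≤ H * T := by gcongr
  have hκx2 : κ ≤ x ^ 2 := by
    have := Real.log_le_sub_one_of_pos (by positivity : 0 < 1 + x ^ 2)
    linarith
  by_cases hx1 : x ≤ 1
  · right; left
    refine hdet T hmT ?_ ?_ ?_
    · have h1 := half_le_log_one_add hx0 hx1
      calc x ^ 2 * T = 4 * T * (x / 2) ^ 2 := by ring
        _ ≤ 4 * T * L ^ 2 := by gcongr
    · have := Real.log_le_self (by linarith : (0 : ℝ) ≤ T)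
      linarith
    · exact hκx2.trans ((pow_le_one₀ hx0 hx1).trans hT1)
  push Not at hx1
  have hL1 := one_half_le_log_one_add hx1.le
  by_cases hlT : l ≤ T
  swap
  · left
    push Not at hlT
    exact htriv hx1.le (by linarith)
  by_cases hsmall : x ^ 2 ≤ √T ∧ m ≤ √T
  · right; left
    refine hdet (√T) hsmall.2 ?_ hlTs (hκx2.trans hsmall.1)
    have hs0 := Real.sqrt_nonneg T
    have h1 := Real.mul_self_sqrt (by linarith : (0 : ℝ) ≤ T)
    have h2 : x ^ 2 * √T ≤ T := by
      calc x ^ 2 * √T ≤ √T * √T := mul_le_mul_of_nonneg_right hsmall.1 hs0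
        _ = T := h1
    calc x ^ 2 * √T ≤ 4 * T * (1 / 2) ^ 2 := by linarith
      _ ≤ 4 * T * L ^ 2 := by gcongr
  · right; right
    rw [hlTδ]
    refine potential_bound_le hdx0 hdφ1 hq hl hT1 hH1 hL1 hD hB2 hκ0
      (hκx.trans (log_one_add_sq_le hx1.le)) ?_ hlTs hlT
    rw [not_and_or, not_le, not_le] at hsmall
    rcases hsmall with h | h
    · have h1 := Real.log_le_log (Real.sqrt_pos.2 (by linarith)) h.le
      rw [Real.log_sqrt (by linarith), Real.log_pow] at h1
      have h2 := Real.log_le_log (by linarith) (by linarith : x ≤ 1 + x)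
      push_cast at h1
      linarith
    · linarith

end Arithmetic

/-! ### The regret for the regularizers of the theorem -/

section Assembly

variable {dx dφ : ℕ} {U : Type} [MeasurableSpace U] {H : ℕ}

/-- The regret bound for the regularizer `λ = σ² / m`. Both regularizers of the theorem have this
form, with `q = BA` and `q = BA ^ 2`. -/
lemma ofReal_le_measure_regret_le_of_regularizer {T : ℕ} {σ : ℝ} (hσ : 0 < σ) (x₁ : Vec dx)
    {φ : Vec dx → U → Vec dφ}
    (hφ : Measurable (Function.uncurry φ)) {cost : Fin H → Vec dx → U → ℝ}
    (hc : ∀ h, Measurable (Function.uncurry (cost h))) (hc0 : ∀ h x u, 0 ≤ cost h x u)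
    {cmax : ℝ} (hcm : ∀ s : Fin H → Vec dx × U, totalCost cost s ≤ cmax)
    {BA δ lam : ℝ} {Pol : Set (Policy dx U)} {L : Learner dx U H}
    (hL : IsLC3 σ x₁ φ cost Pol T BA δ lam L) {A : Matrix (Fin dx) (Fin dφ) ℝ} (hA : ‖A‖ ≤ BA)
    (hH : 1 ≤ H) (hT : 1 ≤ T) (hBA : 0 < BA) (hδ : 0 < δ) (hδ1 : δ < 1) {b : ℝ}
    (hφb : ∀ x u, ‖φ x u‖ ≤ b) {q m : ℝ} (hq : 0 ≤ q) (hm : 1 ≤ m) (hmq : m ≤ 1 + q)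
    (hBAq : BA ^ 2 ≤ m * q) (hcase : m ≤ T ∨ σ ≤ b * H * T) (hlam : lam = σ ^ 2 / m) :
    ENNReal.ofReal (1 - δ) ≤ runLaw σ x₁ φ A L T
      {d | regret σ x₁ φ cost Pol A L d ≤
        600 * cmax * H * √(dφ * (dφ + dx + q + Real.log (1 / δ)) * T)
          * Real.log (1 + b * H * T / σ)} := by
  have hPr := isProbabilityMeasure_runLaw σ x₁ hφ A hL.1 T
  have hlam0 : 0 < lam := by rw [hlam]; positivity
  -- the first input of the first policy shows that there is an input
  obtain ⟨u₀⟩ : Nonempty U := by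
    have := ((L 0 Fin.elim0).isMarkov 0).isProbabilityMeasure (Fin.elim0, x₁)
    exact nonempty_of_isProbabilityMeasure ((L 0 Fin.elim0).act 0 (Fin.elim0, x₁))
  have hb : 0 ≤ b := (norm_nonneg _).trans (hφb x₁ u₀)
  have hcm0 : 0 ≤ cmax :=
    (Finset.sum_nonneg fun h _ => hc0 h _ _).trans (hcm fun _ => (x₁, u₀))
  set R := 600 * H * √(dφ * (dφ + dx + q + Real.log (1 / δ)) * T) *
    Real.log (1 + b * H * T / σ) with hR
  have hgoal : 600 * cmax * H * √(dφ * (dφ + dx + q + Real.log (1 / δ)) * T)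
      * Real.log (1 + b * H * T / σ) = cmax * R := by rw [hR]; ring
  rw [hgoal]
  rcases Nat.eq_zero_or_pos dφ with hd0 | hd0
  · -- without features all parameters are the same
    subst hd0
    have hφ0 : ∀ x u, ‖φ x u‖ ≤ 0 := fun x u => by
      rw [Subsingleton.elim (φ x u) 0, norm_zero]
    refine ofReal_le_measure_regret_le hσ x₁ hφ hc hc0 hcm0 hcm hlam0 hL hA hH hT hδ hδ1 le_rfl
      hφ0 rfl rfl (Or.inl ?_)
    rw [hR]
    simp
  rcases regret_bound_cases (dx := dx) (dφ := dφ) (T := T) (H := H) (Nat.cast_nonneg _)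
    (by exact_mod_cast hd0) (by exact_mod_cast hH) (by exact_mod_cast hT) hσ hBA hb hδ hδ1 hq hm
    hmq hBAq hcase hlam rfl rfl with h | h
  · have huniv : {d : Fin T → Hist dx U H | regret σ x₁ φ cost Pol A L d ≤ cmax * R} =
        Set.univ := by
      refine Set.eq_univ_of_forall fun d => ?_
      exact (regret_le_cmax_mul σ x₁ hφ hc hc0 hcm0 hcm Pol A L d).trans
        (mul_le_mul_of_nonneg_left h hcm0)
    rw [huniv, measure_univ, ← ENNReal.ofReal_one]
    exact ENNReal.ofReal_le_ofReal (by linarith)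
  · exact ofReal_le_measure_regret_le hσ x₁ hφ hc hc0 hcm0 hcm hlam0 hL hA hH hT hδ hδ1 hb
      hφb rfl rfl h

end Assembly

end LC3

theorem mainTheorem6 :
    ∃ C : ℝ, 0 < C ∧
      ∀ (dx du dφ H T : ℕ) (𝒰 : Set (LC3.Vec du)) (σ BA Bφ cmax δ lam : ℝ)
        (x₁ : LC3.Vec dx) (φ : LC3.Vec dx → 𝒰 → LC3.Vec dφ)
        (cost : Fin H → LC3.Vec dx → 𝒰 → ℝ) (Astar : Matrix (Fin dx) (Fin dφ) ℝ)
        (Pol : Set (LC3.Policy dx 𝒰)) (L : LC3.Learner dx 𝒰 H),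
        1 ≤ H → 1 ≤ T → 0 < σ → 0 < BA → 0 < δ → δ < 1 →
        Measurable (Function.uncurry φ) →
        (∀ h, Measurable (Function.uncurry (cost h))) →
        (∀ h x u, 0 ≤ cost h x u) →
        -- the norm of a matrix is its operator norm
        ‖Astar‖ ≤ BA →
        (∀ x u, ‖φ x u‖ ≤ Bφ) →
        (∀ s : Fin H → LC3.Vec dx × 𝒰, LC3.totalCost cost s ≤ cmax) →
        LC3.IsLC3 σ x₁ φ cost Pol T BA δ lam L →
        -- regularizer `σ² / max {1, B_A}`
        (lam = σ ^ 2 / max 1 BA → (BA ≤ T ∨ σ ≤ Bφ * H * T) →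
          ENNReal.ofReal (1 - δ) ≤ LC3.runLaw σ x₁ φ Astar L T
            {d | LC3.regret σ x₁ φ cost Pol Astar L d ≤
              C * cmax * H * √(dφ * (dφ + dx + BA + Real.log (1 / δ)) * T)
                * Real.log (1 + Bφ * H * T / σ)}) ∧
        -- regularizer `σ²`
        (lam = σ ^ 2 →
          ENNReal.ofReal (1 - δ) ≤ LC3.runLaw σ x₁ φ Astar L T
            {d | LC3.regret σ x₁ φ cost Pol Astar L d ≤
              C * cmax * H * √(dφ * (dφ + dx + BA ^ 2 + Real.log (1 / δ)) * T)
                * Real.log (1 + Bφ * H * T / σ)}) := by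
  refine ⟨600, by norm_num, ?_⟩
  intro dx du dφ H T 𝒰 σ BA Bφ cmax δ lam x₁ φ cost Astar Pol L hH hT hσ hBA hδ hδ1 hφ hc hc0 hA
    hφb hcm hL
  constructor
  · intro hlam hcase
    refine LC3.ofReal_le_measure_regret_le_of_regularizer hσ x₁ hφ hc hc0 hcm hL hA hH hT hBA hδ hδ1
      hφb hBA.le (le_max_left 1 BA) (max_le (by linarith) (by linarith)) ?_ ?_ hlam
    · rw [sq]
      exact mul_le_mul_of_nonneg_right (le_max_right 1 BA) hBA.le
    · exact hcase.imp_left fun h => max_le (by exact_mod_cast hT) h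
  · intro hlam
    exact LC3.ofReal_le_measure_regret_le_of_regularizer hσ x₁ hφ hc hc0 hcm hL hA hH hT hBA hδ hδ1
      hφb (sq_nonneg BA) le_rfl (by linarith [sq_nonneg BA]) (by rw [one_mul])
      (Or.inl (by exact_mod_cast hT)) (by rw [hlam, div_one])
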